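/- For $P\in\mathbb{C}[x,y]$ let $m(P)=\frac{1}{(2\pi i)^2}\int_{|x|=|y|=1}\log|P(x,y)|\,\frac{dx}{x}\frac{dy}{y}$ be its logarithmic Mahler measure (and similarly in one variable). Let $D$ be the Bloch–Wigner dilogarithm on $\mathbb{P}^1(\mathbb{C})$: $D(z)=\mathrm{Im}(\mathrm{Li}_2(z))+\log|z|\arg(1-z)$ for $z\in\mathbb{C}\smallsetminus[1,\infty)$, and $D=0$ on $[1,\infty)$ and at $\infty$. Let $P\in\mathbb{C}[x,y]$ be irreducible, with leading coefficient $\lambda(x)$ as a polynomial in $y$, and suppose that $P=0$ is parametrized by $$x=f(t)=\lambda_1\prod_r(t-\alpha_r)^{l_r},\qquad y=g(t)=\lambda_2\prod_s(t-\beta_s)^{m_s},$$ where $\lambda_1,\lambda_2\in\mathbb{C}$, the $\alpha_r\in\mathbb{C}$ are distinct, the $\beta_s\in\mathbb{C}$ are distinct, and the $l_r,m_s$ are non-zero integers; that is, $P(f,g)=0$ identically, and every nonsingular point $(x,y)$ of the curve $P=0$ equals $(f(t),g(t))$ for exactly one $t\in\mathbb{P}^1(\mathbb{C})$. Put $$\tilde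 g(\alpha_r)=\lambda_2\prod_{s:\,\beta_s\ne\alpha_r}(\alpha_r-\beta_s)^{m_s},\qquad \tilde f(\beta_s)=\lambda_1\prod_{r:\,\alpha_r\ne\beta_s}(\beta_s-\alpha_r)^{l_r}.$$ Let $S$ be the set of points $(x,y)$ of the curve $P=0$ with $|x|=1$ and $|y|\ge1$ (points at infinity with $|x|=1$, $y=\infty$ included), and let $\gamma_1,\dots,\gamma_n$ be the paths in $\mathbb{P}^1(\mathbb{C})$ which map to $S$ under $t\mapsto(f(t),g(t))$, oriented so that $f$ moves counterclockwise on the unit circle along each $\gamma_j$. That is, the $\gamma_j$ are continuous, are contained in $\mathbb{C}$ and differentiable apart from finitely many parameter values, are mapped to $S$, and together traverse the preimage of $S$ exactly once up to finitely many points. Let $u_j$ and $v_j$ be the initial and terminal points of $\gamma_j$ (equal if $\gamma_j$ is a loop), and let $\mathrm{wind}(\gamma_j,a)=\mathrm{Im}\int_{\gamma_j}\frac{dt}{t-a}$. Then $$2\pi m(P)=2\pi m(\lambda(x))+\sum_{j=1}^n\Biggl[\sum_{\substack{r,s\\ \alpha_r\ne\beta_s}}l_rm_s\left(D\!\left(\frac{u_j-\alpha_r}{\beta_s-\alpha_r}\right)-D\!\left(\frac{v_j-\alpha_r}{\beta_s-\alpha_r}\right)\right)+\sum_r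 l_r\log|\tilde g(\alpha_r)|\cdot\mathrm{wind}(\gamma_j,\alpha_r)-\sum_s m_s\log|\tilde f(\beta_s)|\cdot\mathrm{wind}(\gamma_j,\beta_s)\Biggr].$$ -/

import Mathlib

open scoped Polynomial

namespace MahlerEval

noncomputable section

/-- The logarithmic Mahler measure of a polynomial in two variables (the inner variable of
`ℂ[X][X]` is `x`, the outer variable is `y`):
`m(P) = (2π)⁻² ∫∫_{[0,2π]²} log |P(e^{iθ}, e^{iφ})| dθ dφ`. -/
def logMahler₂ (P : Polynomial (Polynomial ℂ)) : ℝ :=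
  (2 * Real.pi)⁻¹ ^ 2 *
    ∫ p in Set.Icc (0 : ℝ) (2 * Real.pi) ×ˢ Set.Icc (0 : ℝ) (2 * Real.pi),
      Real.log ‖P.evalEval (Complex.exp (p.1 * Complex.I)) (Complex.exp (p.2 * Complex.I))‖

/-- The dilogarithm `Li₂(z) = -∫₀¹ log(1 - z u) / u du`, used on `ℂ ∖ [1, ∞)`. -/
def li2 (z : ℂ) : ℂ :=
  -∫ u in (0 : ℝ)..1, Complex.log (1 - z * u) / u

open Classical in
/-- The Bloch–Wigner dilogarithm on `ℙ¹(ℂ)`: it is `Im Li₂(z) + log|z| arg(1 - z)` on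
`ℂ ∖ [1, ∞)`, extended (continuously) by `0` to `[1, ∞)` and to the point at infinity. -/
def blochWigner (z : OnePoint ℂ) : ℝ :=
  z.elim 0 fun w =>
    if w.im = 0 ∧ 1 ≤ w.re then 0
    else (li2 w).im + Real.log ‖w‖ * Complex.arg (1 - w)

/-- The map `ℙ¹(ℂ) → ℙ¹(ℂ)` defined by a rational function. -/
def evalP1 (f : RatFunc ℂ) (t : OnePoint ℂ) : OnePoint ℂ :=
  t.elim
    (if f.denom.natDegree < f.num.natDegree then OnePoint.infty
      else ((f.num.coeff f.denom.natDegree / f.denom.leadingCoeff : ℂ) : OnePoint ℂ))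
    fun z => if f.denom.eval z = 0 then OnePoint.infty
      else ((f.num.eval z / f.denom.eval z : ℂ) : OnePoint ℂ)

/-- The rational function `c ∏ᵢ (t - ρᵢ)^{eᵢ}`. -/
def factored {k : ℕ} (c : ℂ) (ρ : Fin k → ℂ) (e : Fin k → ℤ) : RatFunc ℂ :=
  RatFunc.C c * ∏ i, (RatFunc.X - RatFunc.C (ρ i)) ^ e i

open Classical in
/-- The value at `z` of `c ∏ᵢ (t - ρᵢ)^{eᵢ}` after the factor vanishing at `z`, if there is
one, has been omitted. -/
def tildeEval {k : ℕ} (c : ℂ) (ρ : Fin k → ℂ) (e : Fin k → ℤ) (z : ℂ) : ℂ :=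
  c * ∏ i ∈ Finset.univ.filter (fun i => ρ i ≠ z), (z - ρ i) ^ e i

/-- `(x, y)` is a nonsingular point of the affine curve `P(x, y) = 0`: it lies on the curve, and
`∂P/∂x` and `∂P/∂y` do not both vanish there. -/
def IsNonsingularPoint (P : Polynomial (Polynomial ℂ)) (x y : ℂ) : Prop :=
  P.evalEval x y = 0 ∧
    ((Polynomial.derivative (P.eval (Polynomial.C y))).eval x ≠ 0 ∨
      (Polynomial.derivative P).evalEval x y ≠ 0)

/-- `t ↦ (f(t), g(t))` parametrizes the irreducible curve `P(x, y) = 0`: the relation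
`P(f, g) = 0` holds identically, and the map is a bijection from (part of) `ℙ¹(ℂ)` onto the
nonsingular points, i.e. each of these comes from exactly one `t ∈ ℙ¹(ℂ)`. -/
structure IsParametrization (P : Polynomial (Polynomial ℂ)) (f g : RatFunc ℂ) : Prop where
  irreducible : Irreducible P
  relation : Polynomial.aevalAeval f g P = 0
  bijective : ∀ x y : ℂ, IsNonsingularPoint P x y →
    ∃! t : OnePoint ℂ, evalP1 f t = (x : OnePoint ℂ) ∧ evalP1 g t = (y : OnePoint ℂ)

/-- The finite coordinate of a point of `ℙ¹(ℂ)` (with the irrelevant value `0` at `∞`). -/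
def finitePart (t : OnePoint ℂ) : ℂ := t.elim 0 id

/-- A path in `ℙ¹(ℂ)`, parametrized by a nontrivial closed interval: it is continuous, and,
apart from finitely many parameter values, it stays in `ℂ` and is differentiable. -/
structure SpherePath where
  lo : ℝ
  hi : ℝ
  lo_lt_hi : lo < hi
  toFun : ℝ → OnePoint ℂ
  continuousOn : ContinuousOn toFun (Set.Icc lo hi)
  differentiable : ∃ E : Set ℝ, E.Finite ∧ ∀ s ∈ Set.Ioo lo hi \ E,
    toFun s ≠ OnePoint.infty ∧ DifferentiableAt ℝ (fun s' => finitePart (toFun s')) s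

/-- The initial point of a path. -/
def SpherePath.initial (γ : SpherePath) : OnePoint ℂ := γ.toFun γ.lo

/-- The terminal point of a path. -/
def SpherePath.terminal (γ : SpherePath) : OnePoint ℂ := γ.toFun γ.hi

/-- The winding angle `Im ∫_γ dt / (t - a)` of the path `γ` around the point `a`. -/
def wind (γ : SpherePath) (a : ℂ) : ℝ :=
  ∫ s in γ.lo..γ.hi,
    (deriv (fun s' => finitePart (γ.toFun s')) s / (finitePart (γ.toFun s) - a)).im

/-- The path `γ` is mapped by `f` into the unit circle and is oriented via `f`: the point
`f(γ(s)) = e^{iφ(s)}` moves around the circle in the counterclockwise direction. -/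
def SpherePath.IsOrientedVia (γ : SpherePath) (f : RatFunc ℂ) : Prop :=
  ∃ φ : ℝ → ℝ, ContinuousOn φ (Set.Icc γ.lo γ.hi) ∧ StrictMonoOn φ (Set.Icc γ.lo γ.hi) ∧
    ∀ s ∈ Set.Icc γ.lo γ.hi,
      evalP1 f (γ.toFun s) = ((Complex.exp (φ s * Complex.I) : ℂ) : OnePoint ℂ)

/-- The affine points `(x, y)` of the zero locus of `P` with `|x| = 1` and `|y| ≥ 1`. -/
def outerSet (P : Polynomial (Polynomial ℂ)) : Set (ℂ × ℂ) :=
  {q | P.evalEval q.1 q.2 = 0 ∧ ‖q.1‖ = 1 ∧ 1 ≤ ‖q.2‖}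

/-- The points `t ∈ ℙ¹(ℂ)` which `t ↦ (f(t), g(t))` sends to points of the zero locus of `P` with
`|x| = 1` and `|y| ≥ 1`, including the points at infinity of the curve with `|x| = 1`,
`y = ∞`. -/
def outerPreimage (P : Polynomial (Polynomial ℂ)) (f g : RatFunc ℂ) : Set (OnePoint ℂ) :=
  {t | ∃ x : ℂ, evalP1 f t = (x : OnePoint ℂ) ∧
    ((∃ y : ℂ, evalP1 g t = (y : OnePoint ℂ) ∧ (x, y) ∈ outerSet P) ∨
      (‖x‖ = 1 ∧ evalP1 g t = OnePoint.infty))}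

/-- `γ₁, …, γₙ` are the paths which map to the points of the curve with `|x| = 1` and `|y| ≥ 1`:
they are oriented via `f`, they run inside the preimage of this set, and together they traverse
all of this preimage exactly once, up to finitely many points (such as the common endpoints and
the crossings of paths). -/
structure ArePathsOver (P : Polynomial (Polynomial ℂ)) (f g : RatFunc ℂ) {n : ℕ}
    (γ : Fin n → SpherePath) : Prop where
  oriented : ∀ j, (γ j).IsOrientedVia f
  mapsTo : ∀ j, ∀ s ∈ Set.Icc (γ j).lo (γ j).hi, (γ j).toFun s ∈ outerPreimage P f g
  covers : ∃ F : Set (OnePoint ℂ), F.Finite ∧ ∀ t ∈ outerPreimage P f g \ F,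
    ∃! p : Fin n × ℝ, p.2 ∈ Set.Icc (γ p.1).lo (γ p.1).hi ∧ (γ p.1).toFun p.2 = t

/-- The dilogarithm value `D((u - a) / (b - a))`, where the point `u` may be `∞`. -/
def dilogTerm (a b : ℂ) (u : OnePoint ℂ) : ℝ :=
  blochWigner (OnePoint.map (fun t => (t - a) / (b - a)) u)

end

end MahlerEval

/-! Write `λ` for the leading coefficient. Jensen's formula in `y` and Fubini turn `2π m(P) - 2π
m(λ)` into the integral over the circle `x = e^{iθ}` of the sum of `log⁺|y|` over the roots `y` of
`P(x, ·)` (`logMahler₂_eq_integral`). For all but finitely many `x` these roots are simple, so the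
points `(x, y)` are nonsingular, come from unique parameters `t`, and those with `|y| ≥ 1` are met
exactly once by the paths. Hence the integral is the sum over `j` of `∫ log|g| d arg f` along `γ_j`
(`integral_sumPosLogRoots_eq`).

Each path integral is then evaluated by a primitive. The Bloch–Wigner function satisfies `dD(z) =
log|z| d arg(1 - z) - log|1 - z| d arg z` (`hasDerivAt_blochWigner`). On a path `log|f| = 0`, so
`log|g| d arg f = log|g| d arg f - log|f| d arg g`, which is bilinear and antisymmetric in the
factors of `f` and `g`. The pair `(α_r, β_s)` contributes `-l_r m_s dD((t - α_r)/(β_s - α_r))` plus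
multiples of `log|β_s - α_r|` times winding forms; pairs with `α_r = β_s` cancel. The constants add
up to `log|g̃(α_r)|` and `log|f̃(β_s)|` (`integral_log_norm_mul_deriv`).

The analytic difficulty is that the paths are merely continuous on the sphere and differentiable off
a finite set, with no rectifiability assumed, and may pass through infinity, through points `β_s`,
or through critical points of `f`. The strictly increasing argument `φ` of `f` replaces
rectifiability. Near each point `f - f(t₀)` is a power of a local coordinate times a unit, so the
speed of the path is dominated by the derivative of a monotone function of `φ`, which is
automatically integrable (`exists_monotoneOn_bound_deriv`). This makes all winding forms integrable
(`intervalIntegrable_im_logDeriv`). Integrability of `log|g| d arg f` comes from Jensen's formula,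
by changing variables in nonnegative extended integrals. -/

namespace MahlerEval
open Set Filter Topology MeasureTheory

/-! ### The dilogarithm integral -/

lemma one_sub_mul_mem_slitPlane {z : ℂ} (hz : 1 - z ∈ Complex.slitPlane) {u : ℝ}
    (h0 : 0 ≤ u) (h1 : u ≤ 1) : 1 - z * u ∈ Complex.slitPlane := by
  have := Complex.starConvex_one_slitPlane.add_smul_sub_mem hz h0 h1
  convert this using 1
  simp [Complex.real_smul]
  ring

/-- Compactness makes the bound uniform in both variables, which gives the domination for
differentiating under the integral sign. -/
lemma exists_bound_inv_one_sub_mul {z : ℂ} (hz : 1 - z ∈ Complex.slitPlane) :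
    ∃ ε > 0, ∃ C : ℝ, ∀ x ∈ Metric.ball z ε, 1 - x ∈ Complex.slitPlane ∧
      ∀ u ∈ Icc (0 : ℝ) 1, ‖(1 - x * u)⁻¹‖ ≤ C := by
  have hopen : IsOpen {x : ℂ | 1 - x ∈ Complex.slitPlane} :=
    Complex.isOpen_slitPlane.preimage (continuous_const.sub continuous_id)
  obtain ⟨ε, hε, hsub⟩ := Metric.nhds_basis_closedBall.mem_iff.1 (hopen.mem_nhds hz)
  have hK : IsCompact (Metric.closedBall z ε ×ˢ Icc (0 : ℝ) 1) :=
    (isCompact_closedBall z ε).prod isCompact_Icc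
  have hc : ContinuousOn (fun q : ℂ × ℝ => (1 - q.1 * q.2)⁻¹)
      (Metric.closedBall z ε ×ˢ Icc (0 : ℝ) 1) := by
    refine ContinuousOn.inv₀ (by fun_prop) ?_
    rintro ⟨x, u⟩ ⟨hx, hu⟩
    exact Complex.slitPlane_ne_zero (one_sub_mul_mem_slitPlane (hsub hx) hu.1 hu.2)
  obtain ⟨C, hC⟩ := hK.exists_bound_of_continuousOn hc
  exact ⟨ε, hε, C, fun x hx => ⟨hsub (Metric.ball_subset_closedBall hx), fun u hu =>
    hC (x, u) ⟨Metric.ball_subset_closedBall hx, hu⟩⟩⟩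

lemma hasDerivAt_log_one_sub_mul {z : ℂ} (hz : 1 - z ∈ Complex.slitPlane) {u : ℝ}
    (h0 : 0 ≤ u) (h1 : u ≤ 1) :
    HasDerivAt (fun u : ℝ => Complex.log (1 - z * u)) (-z * (1 - z * u)⁻¹) u := by
  have h : HasDerivAt (fun u : ℝ => 1 - z * (u : ℂ)) (-z) u := by
    have := ((Complex.ofRealCLM.hasDerivAt (x := u)).const_mul z).const_sub 1
    simpa using this
  simpa [div_eq_mul_inv] using h.clog_real (one_sub_mul_mem_slitPlane hz h0 h1)

/-- The singularity at `u = 0` is removable: by the mean value inequality `log(1 - zu)` is at most a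
constant times `u`. -/
lemma intervalIntegrable_li2_integrand {z : ℂ} (hz : 1 - z ∈ Complex.slitPlane) :
    IntervalIntegrable (fun u : ℝ => Complex.log (1 - z * u) / u) volume 0 1 := by
  obtain ⟨ε, hε, C, hC⟩ := exists_bound_inv_one_sub_mul hz
  have hCz := (hC z (Metric.mem_ball_self hε)).2
  rw [intervalIntegrable_iff_integrableOn_Ioc_of_le zero_le_one]
  refine Integrable.mono' (g := fun _ => ‖z‖ * C) (integrable_const _) ?_ ?_
  · have hc : ContinuousOn (fun u : ℝ => Complex.log (1 - z * u) / u) (Ioc 0 1) := ?_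
    · exact hc.aestronglyMeasurable measurableSet_Ioc
    refine fun u hu => ContinuousAt.continuousWithinAt ?_
    exact (hasDerivAt_log_one_sub_mul hz hu.1.le hu.2).continuousAt.div
      Complex.continuous_ofReal.continuousAt (by exact_mod_cast hu.1.ne')
  · refine (ae_restrict_iff' (measurableSet_Ioc (α := ℝ))).2 (.of_forall fun u hu => ?_)
    have := (convex_Icc (0 : ℝ) 1).norm_image_sub_le_of_norm_hasDerivWithin_le
      (f := fun u : ℝ => Complex.log (1 - z * u)) (f' := fun u : ℝ => -z * (1 - z * u)⁻¹)
      (C := ‖z‖ * C) (x := 0) (y := u)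
      (fun v hv => (hasDerivAt_log_one_sub_mul hz hv.1 hv.2).hasDerivWithinAt)
      (fun v hv => by
        rw [norm_mul, norm_neg]
        exact mul_le_mul_of_nonneg_left (hCz v hv) (norm_nonneg _))
      (by simp) ⟨hu.1.le, hu.2⟩
    simp only [Complex.ofReal_zero, mul_zero, sub_zero, Complex.log_one] at this
    rw [norm_div, Complex.norm_real, div_le_iff₀ (norm_pos_iff.2 hu.1.ne')]
    exact this

/-- The derivative is left as an integral because this form also covers `z = 0`, where `-log(1 -
z)/z` takes the wrong default value. -/
lemma hasDerivAt_li2_integral {z : ℂ} (hz : 1 - z ∈ Complex.slitPlane) :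
    HasDerivAt li2 (∫ u in (0 : ℝ)..1, (1 - z * u)⁻¹) z := by
  obtain ⟨ε, hε, C, hC⟩ := exists_bound_inv_one_sub_mul hz
  have hmeas : ∀ x ∈ Metric.ball z ε, AEStronglyMeasurable
      (fun u : ℝ => Complex.log (1 - x * u) / u) (volume.restrict (uIoc 0 1)) := fun x hx =>
    ((intervalIntegrable_iff (μ := volume)).1
      (intervalIntegrable_li2_integrand (hC x hx).1)).aestronglyMeasurable
  have key := intervalIntegral.hasDerivAt_integral_of_dominated_loc_of_deriv_le
    (μ := volume) (a := 0) (b := 1) (bound := fun _ => C)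
    (F := fun (x : ℂ) (u : ℝ) => Complex.log (1 - x * u) / u)
    (F' := fun (x : ℂ) (u : ℝ) => -(1 - x * u)⁻¹) (Metric.ball_mem_nhds z hε)
    (by filter_upwards [Metric.ball_mem_nhds z hε] using hmeas)
    (intervalIntegrable_li2_integrand hz) ?_ ?_ (by simp) ?_
  · have := key.2.neg
    rw [intervalIntegral.integral_neg, neg_neg] at this
    exact this
  · rw [uIoc_of_le zero_le_one]
    refine ContinuousOn.aestronglyMeasurable (ContinuousOn.neg (ContinuousOn.inv₀ (by fun_prop) ?_))
      measurableSet_Ioc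
    exact fun u hu => Complex.slitPlane_ne_zero (one_sub_mul_mem_slitPlane hz hu.1.le hu.2)
  · refine .of_forall fun u hu x hx => ?_
    rw [uIoc_of_le zero_le_one] at hu
    rw [norm_neg]
    exact (hC x hx).2 u ⟨hu.1.le, hu.2⟩
  · refine .of_forall fun u hu x hx => ?_
    rw [uIoc_of_le zero_le_one] at hu
    have h1 : HasDerivAt (fun x : ℂ => 1 - x * (u : ℂ)) (-(u : ℂ)) x := by
      simpa using ((hasDerivAt_id x).mul_const (u : ℂ)).const_sub 1
    have h2 := (h1.clog (one_sub_mul_mem_slitPlane (hC x hx).1 hu.1.le hu.2)).div_const (u : ℂ)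
    have hu0 : (u : ℂ) ≠ 0 := by exact_mod_cast hu.1.ne'
    refine h2.congr_deriv ?_
    rw [div_right_comm, neg_div_self hu0, neg_div, one_div]

lemma hasDerivAt_li2 {z : ℂ} (hz : 1 - z ∈ Complex.slitPlane) (hz0 : z ≠ 0) :
    HasDerivAt li2 (-Complex.log (1 - z) / z) z := by
  convert hasDerivAt_li2_integral hz using 1
  have h := intervalIntegral.integral_eq_sub_of_hasDerivAt (a := 0) (b := 1)
    (f := fun u : ℝ => Complex.log (1 - z * u) / (-z)) (f' := fun u : ℝ => (1 - z * u)⁻¹)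
    (fun u hu => by
      rw [uIcc_of_le zero_le_one] at hu
      have := (hasDerivAt_log_one_sub_mul hz hu.1 hu.2).div_const (-z)
      rwa [mul_div_cancel_left₀ _ (neg_ne_zero.2 hz0)] at this)
    (ContinuousOn.intervalIntegrable_of_Icc zero_le_one (ContinuousOn.inv₀ (by fun_prop)
      fun u hu => Complex.slitPlane_ne_zero (one_sub_mul_mem_slitPlane hz hu.1 hu.2)))
  rw [h]
  simp
  rw [div_neg, neg_div]

/-! ### The Bloch–Wigner dilogarithm -/

lemma one_sub_mem_slitPlane_iff {w : ℂ} :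
    1 - w ∈ Complex.slitPlane ↔ ¬ (w.im = 0 ∧ 1 ≤ w.re) := by
  rw [Complex.mem_slitPlane_iff]
  simp
  grind

lemma blochWigner_coe_of_mem {w : ℂ} (hw : 1 - w ∈ Complex.slitPlane) :
    blochWigner (w : OnePoint ℂ) = (li2 w).im + Real.log ‖w‖ * Complex.arg (1 - w) := by
  have := one_sub_mem_slitPlane_iff.1 hw
  simp only [blochWigner, OnePoint.elim_some]
  rw [if_neg this]

lemma blochWigner_infty : blochWigner OnePoint.infty = 0 := rfl

lemma blochWigner_ofReal (x : ℝ) : blochWigner ((x : ℂ) : OnePoint ℂ) = 0 := by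
  simp only [blochWigner, OnePoint.elim_some]
  split_ifs with h
  · rfl
  · have hx : x < 1 := by simpa using h
    have h1 : Complex.arg (1 - x) = 0 := by
      rw [← Complex.ofReal_one, ← Complex.ofReal_sub]
      exact Complex.arg_ofReal_of_nonneg (by linarith)
    have h2 : ∫ u in (0 : ℝ)..1, Complex.log (1 - x * u) / u =
        ((∫ u in (0 : ℝ)..1, Real.log (1 - x * u) / u : ℝ) : ℂ) := by
      rw [← intervalIntegral.integral_ofReal]
      refine intervalIntegral.integral_congr fun u hu => ?_
      rw [uIcc_of_le zero_le_one] at hu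
      have : 0 ≤ 1 - x * u := by nlinarith [hu.1, hu.2]
      simp [Complex.ofReal_log this]
    rw [h1, li2, h2]
    simp

lemma hasDerivAt_log_norm {z : ℝ → ℂ} {z' : ℂ} {s : ℝ} (h : HasDerivAt z z' s) (h0 : z s ≠ 0) :
    HasDerivAt (fun s => Real.log ‖z s‖) (z' / z s).re s := by
  have h1 : HasDerivAt (fun x => Complex.log (z x / z s)) (z' / z s) s := by
    simpa [h0] using (h.div_const (z s)).clog_real (by simp [h0])
  have h2 := (Complex.reCLM.hasFDerivAt.comp_hasDerivAt s h1).const_add (Real.log ‖z s‖)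
  refine h2.congr_of_eventuallyEq ?_
  filter_upwards [h.continuousAt.eventually_ne h0] with x hx
  simp [Complex.log_re, Real.log_div (norm_ne_zero_iff.2 hx) (norm_ne_zero_iff.2 h0)]

/-- Differentiating `log|z|` produces `arg(1 - z) Re(z'/z)`, which cancels the same term in the
derivative of `Im Li₂`. Only the single-valued logarithms of absolute values survive as
coefficients. -/
lemma hasDerivAt_blochWigner_of_mem {z : ℝ → ℂ} {z' : ℂ} {s : ℝ} (h : HasDerivAt z z' s)
    (h0 : z s ≠ 0) (h1 : 1 - z s ∈ Complex.slitPlane) :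
    HasDerivAt (fun s => blochWigner (z s : OnePoint ℂ))
      (Real.log ‖z s‖ * (-z' / (1 - z s)).im - Real.log ‖1 - z s‖ * (z' / z s).im) s := by
  have hl : HasDerivAt (fun s => li2 (z s)) (-Complex.log (1 - z s) / z s * z') s := by
    simpa [Function.comp_def] using (hasDerivAt_li2 h1 h0).comp s h
  have hli := Complex.imCLM.hasFDerivAt.comp_hasDerivAt s hl
  have ha := Complex.imCLM.hasFDerivAt.comp_hasDerivAt s ((h.const_sub 1).clog_real h1)
  have hd := hli.add ((hasDerivAt_log_norm h h0).mul ha)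
  have hev : ∀ᶠ x in 𝓝 s, 1 - z x ∈ Complex.slitPlane :=
    (h.const_sub 1).continuousAt.eventually_mem (Complex.isOpen_slitPlane.mem_nhds h1)
  refine (hd.congr_of_eventuallyEq ?_).congr_deriv ?_
  · filter_upwards [hev] with x hx
    simp [blochWigner_coe_of_mem hx, Complex.log_im]
  · simp only [Complex.imCLM_apply, Function.comp_apply, Complex.log_im]
    have : -Complex.log (1 - z s) / z s * z' = -(Complex.log (1 - z s) * (z' / z s)) := by ring
    rw [this, Complex.neg_im, Complex.mul_im, Complex.log_im, Complex.log_re]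
    ring

/-- The differential of `D` changes sign under `z ↦ 1 - z`, so the sum of both values is constant
along a line, and it vanishes at a real point. This symmetry carries smoothness and continuity
across the cut `[1, ∞)`. -/
lemma blochWigner_one_sub (z : ℂ) :
    blochWigner ((1 - z : ℂ) : OnePoint ℂ) = -blochWigner (z : OnePoint ℂ) := by
  by_cases him : z.im = 0
  · obtain ⟨x, rfl⟩ : ∃ x : ℝ, z = x := ⟨z.re, Complex.ext rfl (by simpa using him)⟩
    rw [← Complex.ofReal_one, ← Complex.ofReal_sub, blochWigner_ofReal, blochWigner_ofReal, neg_zero]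
  -- The line meets the real axis only at `1/2`, so it avoids the singular points and the cuts of
  -- both terms.
  set w : ℝ → ℂ := fun s => 1 / 2 + s * (z - 1 / 2) with hw
  have hwd (s : ℝ) : HasDerivAt w (z - 1 / 2) s := by
    simpa [hw] using ((Complex.ofRealCLM.hasDerivAt (x := s)).mul_const (z - 1 / 2)).const_add (1 / 2)
  have him' (s : ℝ) : (w s).im = s * z.im := by simp [hw]
  have hmem (s : ℝ) : w s ∈ Complex.slitPlane ∧ 1 - w s ∈ Complex.slitPlane := by
    rw [Complex.mem_slitPlane_iff, Complex.mem_slitPlane_iff]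
    by_cases hs : s = 0
    · subst hs
      norm_num [hw]
    · have : (w s).im ≠ 0 := by rw [him']; exact mul_ne_zero hs him
      simp [this]
  have hder (s : ℝ) : HasDerivAt (fun s => blochWigner (w s : OnePoint ℂ) +
      blochWigner ((1 - w s : ℂ) : OnePoint ℂ)) 0 s := by
    have h1 := hasDerivAt_blochWigner_of_mem (hwd s)
      (Complex.slitPlane_ne_zero (hmem s).1) (hmem s).2
    have h2 := hasDerivAt_blochWigner_of_mem (z := fun s => 1 - w s) ((hwd s).const_sub 1)
      (Complex.slitPlane_ne_zero (hmem s).2) (by simpa using (hmem s).1)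
    refine (h1.add h2).congr_deriv ?_
    simp only [sub_sub_cancel, neg_neg]
    ring
  have := is_const_of_deriv_eq_zero (fun s => (hder s).differentiableAt)
    (fun s => (hder s).deriv) 1 0
  have h12 : (1 / 2 : ℂ) = ((1 / 2 : ℝ) : ℂ) := by norm_num
  have h12' : (1 - 1 / 2 : ℂ) = ((1 / 2 : ℝ) : ℂ) := by norm_num
  simp only [hw, Complex.ofReal_zero, zero_mul, add_zero, Complex.ofReal_one, one_mul,
    add_sub_cancel] at this
  rw [h12', h12, blochWigner_ofReal] at this
  linarith

lemma hasDerivAt_blochWigner {z : ℝ → ℂ} {z' : ℂ} {s : ℝ} (h : HasDerivAt z z' s)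
    (h0 : z s ≠ 0) (h1 : z s ≠ 1) :
    HasDerivAt (fun s => blochWigner (z s : OnePoint ℂ))
      (Real.log ‖z s‖ * (-z' / (1 - z s)).im - Real.log ‖1 - z s‖ * (z' / z s).im) s := by
  by_cases hm : 1 - z s ∈ Complex.slitPlane
  · exact hasDerivAt_blochWigner_of_mem h h0 hm
  have hm' : z s ∈ Complex.slitPlane := by
    have := one_sub_mem_slitPlane_iff.not.1 hm
    rw [not_not] at this
    exact Complex.mem_slitPlane_iff.2 (.inl (by linarith [this.2]))
  have h2 := (hasDerivAt_blochWigner_of_mem (z := fun s => 1 - z s) (h.const_sub 1)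
      (sub_ne_zero.2 h1.symm) (by simpa using hm')).neg
  refine (h2.congr_of_eventuallyEq (.of_forall fun x => ?_)).congr_deriv ?_
  · simp [blochWigner_one_sub]
  · simp only [sub_sub_cancel, neg_neg]
    ring

/-- Same argument as for `1 - z`, along a line through the real point `-1`. The inversion reduces
continuity at infinity to continuity at `0`. -/
lemma blochWigner_inv (z : ℂ) :
    blochWigner ((z⁻¹ : ℂ) : OnePoint ℂ) = -blochWigner (z : OnePoint ℂ) := by
  by_cases him : z.im = 0
  · obtain ⟨x, rfl⟩ : ∃ x : ℝ, z = x := ⟨z.re, Complex.ext rfl (by simpa using him)⟩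
    rw [← Complex.ofReal_inv, blochWigner_ofReal, blochWigner_ofReal, neg_zero]
  set w : ℝ → ℂ := fun s => -1 + s * (z + 1) with hw
  have hwd (s : ℝ) : HasDerivAt w (z + 1) s := by
    simpa [hw] using ((Complex.ofRealCLM.hasDerivAt (x := s)).mul_const (z + 1)).const_add (-1)
  have him' (s : ℝ) : (w s).im = s * z.im := by simp [hw]
  have hne (s : ℝ) : w s ≠ 0 ∧ w s ≠ 1 := by
    by_cases hs : s = 0
    · subst hs
      norm_num [hw]
    · have : (w s).im ≠ 0 := by rw [him']; exact mul_ne_zero hs him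
      constructor <;> intro h <;> simp [h] at this
  have hder (s : ℝ) : HasDerivAt (fun s => blochWigner (w s : OnePoint ℂ) +
      blochWigner (((w s)⁻¹ : ℂ) : OnePoint ℂ)) 0 s := by
    obtain ⟨hn0, hn1⟩ := hne s
    have hn1' : 1 - w s ≠ 0 := sub_ne_zero.2 hn1.symm
    have h1 := hasDerivAt_blochWigner (hwd s) hn0 hn1
    have h2 := hasDerivAt_blochWigner (z := fun s => (w s)⁻¹) ((hwd s).inv hn0)
      (inv_ne_zero hn0) (by simpa using hn1)
    refine (h1.add h2).congr_deriv ?_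
    have e1 : -(-(z + 1) / w s ^ 2) / (1 - (w s)⁻¹) =
        -(z + 1) / (1 - w s) - (z + 1) / w s := by
      have : w s - 1 ≠ 0 := sub_ne_zero.2 hn1
      have e : 1 - (w s)⁻¹ = (w s - 1) / w s := by field_simp
      rw [e]
      field_simp
      ring
    have e2 : -(z + 1) / w s ^ 2 / (w s)⁻¹ = -((z + 1) / w s) := by field_simp
    have e3 : Real.log ‖1 - (w s)⁻¹‖ = Real.log ‖1 - w s‖ - Real.log ‖w s‖ := by
      rw [← Real.log_div (norm_ne_zero_iff.2 hn1') (norm_ne_zero_iff.2 hn0), ← norm_div,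
        ← norm_neg ((1 - w s) / w s)]
      congr 2
      field_simp
      ring
    simp only [e1, e2, e3, norm_inv, Real.log_inv, Complex.sub_im, Complex.neg_im]
    ring
  have := is_const_of_deriv_eq_zero (fun s => (hder s).differentiableAt)
    (fun s => (hder s).deriv) 1 0
  have h12 : (-1 : ℂ) = ((-1 : ℝ) : ℂ) := by norm_num
  simp only [hw, Complex.ofReal_zero, zero_mul, add_zero, Complex.ofReal_one, one_mul,
    add_comm z 1, neg_add_cancel_left] at this
  rw [h12, ← Complex.ofReal_inv, blochWigner_ofReal, blochWigner_ofReal] at this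
  linarith

/-- Near `0`, `arg(1 - w)` is `O(|w|)`, which beats the logarithm. -/
lemma continuousAt_log_norm_mul_arg : ContinuousAt
    (fun w : ℂ => Real.log ‖w‖ * Complex.arg (1 - w)) 0 := by
  have hb : ∀ᶠ w : ℂ in 𝓝 0, ‖Real.log ‖w‖ * Complex.arg (1 - w)‖ ≤ 2 * |Real.log ‖w‖ * ‖w‖| := by
    filter_upwards [Metric.ball_mem_nhds (0 : ℂ) (show (0 : ℝ) < 1 / 2 by norm_num)] with w hw
    rw [mem_ball_zero_iff] at hw
    have h1 := Complex.norm_log_one_add_le (z := -w) (by rw [norm_neg]; linarith)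
    rw [norm_neg, ← sub_eq_add_neg] at h1
    have h2 : |Complex.arg (1 - w)| ≤ ‖Complex.log (1 - w)‖ := by
      rw [← Complex.log_im]; exact Complex.abs_im_le_norm _
    have h3 : (1 - ‖w‖)⁻¹ ≤ 2 := by
      rw [inv_le_comm₀ (by linarith) (by norm_num)]; linarith
    have h4 : ‖w‖ ^ 2 * (1 - ‖w‖)⁻¹ / 2 ≤ ‖w‖ := by
      have : ‖w‖ ^ 2 * (1 - ‖w‖)⁻¹ ≤ ‖w‖ ^ 2 * 2 := by gcongr
      nlinarith [norm_nonneg w]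
    rw [norm_mul, abs_mul, abs_norm, Real.norm_eq_abs, Real.norm_eq_abs]
    have : |Complex.arg (1 - w)| ≤ 2 * ‖w‖ := by linarith
    calc _ ≤ |Real.log ‖w‖| * (2 * ‖w‖) := by gcongr
      _ = _ := by ring
  have hlim : Tendsto (fun w : ℂ => 2 * |Real.log ‖w‖ * ‖w‖|) (𝓝 0) (𝓝 0) := by
    have hc : Continuous fun w : ℂ => 2 * |‖w‖ * Real.log ‖w‖| :=
      continuous_const.mul (Real.continuous_mul_log.comp continuous_norm).abs
    have := hc.tendsto 0
    simpa [mul_comm] using this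
  have := squeeze_zero_norm' hb hlim
  simpa [ContinuousAt] using this

lemma continuousAt_blochWigner_of_mem {z : ℂ} (hz : 1 - z ∈ Complex.slitPlane) :
    ContinuousAt (fun w : ℂ => blochWigner (w : OnePoint ℂ)) z := by
  have hev : ∀ᶠ w in 𝓝 z, 1 - w ∈ Complex.slitPlane :=
    (continuous_const.sub continuous_id).continuousAt.eventually_mem
      (Complex.isOpen_slitPlane.mem_nhds hz)
  have hc : ContinuousAt (fun w : ℂ => (li2 w).im + Real.log ‖w‖ * Complex.arg (1 - w)) z := by
    refine (Complex.continuous_im.continuousAt.comp (hasDerivAt_li2_integral hz).continuousAt).add ?_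
    by_cases h0 : z = 0
    · subst h0; exact continuousAt_log_norm_mul_arg
    · refine (continuous_norm.continuousAt.log (norm_ne_zero_iff.2 h0)).mul ?_
      exact (Complex.continuousAt_arg hz).comp (f := fun w : ℂ => 1 - w) (by fun_prop)
  refine hc.congr ?_
  filter_upwards [hev] with w hw
  rw [blochWigner_coe_of_mem hw]

lemma continuous_blochWigner : Continuous blochWigner := by
  rw [OnePoint.continuous_iff]
  constructor
  · have h : Tendsto (fun z : ℂ => -blochWigner ((z⁻¹ : ℂ) : OnePoint ℂ))
        (coclosedCompact ℂ) (𝓝 0) := by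
      rw [coclosedCompact_eq_cocompact]
      have h0 : ContinuousAt (fun w : ℂ => blochWigner (w : OnePoint ℂ)) 0 :=
        continuousAt_blochWigner_of_mem (by simp)
      have hz : blochWigner ((0 : ℂ) : OnePoint ℂ) = 0 := by
        simpa using blochWigner_ofReal 0
      have := (h0.tendsto.comp (tendsto_inv₀_cobounded (α := ℂ))).neg
      simpa [hz, Metric.cobounded_eq_cocompact, Function.comp_def] using this
    simpa [blochWigner_inv, blochWigner_infty] using h
  · rw [continuous_iff_continuousAt]
    intro z
    by_cases hm : 1 - z ∈ Complex.slitPlane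
    · exact continuousAt_blochWigner_of_mem hm
    have hm' : z ∈ Complex.slitPlane := by
      have := one_sub_mem_slitPlane_iff.not.1 hm
      rw [not_not] at this
      exact Complex.mem_slitPlane_iff.2 (.inl (by linarith [this.2]))
    have h := ((continuousAt_blochWigner_of_mem (z := 1 - z) (by simpa using hm')).comp
      (f := fun w : ℂ => 1 - w) (by fun_prop)).neg
    refine h.congr (.of_forall fun w => ?_)
    simp [blochWigner_one_sub]

/-! ### Local integrability of logarithmic derivatives along a path -/

/-- A continuous argument is automatically differentiable: while it varies by less than `π` it
equals a constant plus the imaginary part of the principal logarithm of `h / h(s)`. -/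
lemma hasDerivAt_of_exp_mul_I {h : ℝ → ℂ} {h' : ℂ} {φ : ℝ → ℝ} {s : ℝ} (hh : HasDerivAt h h' s)
    (hφ : ContinuousAt φ s) (he : ∀ᶠ x in 𝓝 s, h x = Complex.exp (φ x * Complex.I)) :
    HasDerivAt φ (h' / h s).im s := by
  have hs : h s = Complex.exp (φ s * Complex.I) := he.self_of_nhds
  have h0 : h s ≠ 0 := by rw [hs]; exact Complex.exp_ne_zero _
  have h1 : HasDerivAt (fun x => Complex.log (h x / h s)) (h' / h s) s := by
    simpa [h0] using (hh.div_const (h s)).clog_real (by simp [h0])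
  have h2 := (Complex.imCLM.hasFDerivAt.comp_hasDerivAt s h1).const_add (φ s)
  refine h2.congr_of_eventuallyEq ?_
  have hev : ∀ᶠ x in 𝓝 s, φ x - φ s ∈ Ioo (-Real.pi) Real.pi :=
    (hφ.sub continuousAt_const).eventually_mem
      (by simpa using Ioo_mem_nhds (neg_lt_zero.2 Real.pi_pos) Real.pi_pos)
  filter_upwards [he, hev] with x hx hx'
  have : h x / h s = Complex.exp ((φ x - φ s : ℝ) * Complex.I) := by
    rw [hx, hs, ← Complex.exp_sub]; push_cast; ring_nf
  simp only [Function.comp_apply, this, Complex.imCLM_apply]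
  rw [Complex.log_exp (by simpa using hx'.1) (by simpa using hx'.2.le)]
  simp

lemma half_abs_le_norm_exp_mul_I_sub_one {v : ℝ} (hv : |v| ≤ 1) :
    |v| / 2 ≤ ‖Complex.exp (v * Complex.I) - 1‖ := by
  rw [mul_comm, Complex.norm_exp_I_mul_ofReal_sub_one]
  have h := Real.mul_abs_le_abs_sin (x := v / 2) (by
    rw [abs_div, abs_two]; linarith [Real.pi_gt_three])
  rw [norm_mul, Real.norm_eq_abs, Real.norm_eq_abs, abs_two]
  rw [abs_div, abs_two] at h
  have : (1 / 2 : ℝ) ≤ 2 / Real.pi := by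
    rw [le_div_iff₀ Real.pi_pos]; linarith [Real.pi_le_four]
  nlinarith [abs_nonneg v]

/-- Inscribed angle theorem: the direction of the chord `e^{iv} - 1` turns at half the speed of `v`.
Thus the angular part has no singularity at `v = 0`. -/
lemma im_I_mul_exp_div {v : ℝ} (h : Complex.exp (v * Complex.I) - 1 ≠ 0) :
    (Complex.I * Complex.exp (v * Complex.I) / (Complex.exp (v * Complex.I) - 1)).im = 1 / 2 := by
  set E := Complex.exp (v * Complex.I) with hE
  have hE0 : E ≠ 0 := Complex.exp_ne_zero _
  have hc : (starRingEnd ℂ) E = E⁻¹ := by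
    rw [hE, ← Complex.exp_conj, ← Complex.exp_neg]
    simp
  set ζ := Complex.I * E / (E - 1) with hζ
  have h1 : ζ - (starRingEnd ℂ) ζ = Complex.I := by
    have h2 : E⁻¹ - 1 ≠ 0 := by
      intro h3
      apply h
      rw [sub_eq_zero, inv_eq_one] at h3
      rw [h3, sub_self]
    have h3 : E⁻¹ - 1 = -(E - 1) / E := by field_simp; ring
    rw [hζ]
    simp only [map_div₀, map_mul, map_sub, map_one, hc, Complex.conj_I]
    rw [h3]
    field_simp
  have h2 := congrArg Complex.im h1
  simp only [Complex.sub_im, Complex.conj_im, Complex.I_im] at h2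
  linarith

/-- The odd extension of the power function `v ↦ v ^ p`. -/
noncomputable def oddRpow (p v : ℝ) : ℝ := max v 0 ^ p - max (-v) 0 ^ p

lemma monotone_oddRpow {p : ℝ} (hp : 0 ≤ p) : Monotone (oddRpow p) := fun v w hvw => by
  refine sub_le_sub (Real.rpow_le_rpow (le_max_right _ _) (max_le_max_right 0 hvw) hp)
    (Real.rpow_le_rpow (le_max_right _ _) (max_le_max_right 0 (neg_le_neg hvw)) hp)

lemma hasDerivAt_oddRpow {p v : ℝ} (hp : p ≠ 0) (hv : v ≠ 0) :
    HasDerivAt (oddRpow p) (p * |v| ^ (p - 1)) v := by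
  rcases lt_or_gt_of_ne hv with h | h
  · have := ((hasDerivAt_neg v).rpow_const (p := p) (.inl (by linarith))).neg
    refine (this.congr_of_eventuallyEq ?_).congr_deriv ?_
    · filter_upwards [eventually_lt_nhds h] with x hx
      rw [oddRpow, max_eq_right hx.le, max_eq_left (by linarith), Real.zero_rpow hp, zero_sub]
      rfl
    · rw [abs_of_neg h]; ring
  · have := (hasDerivAt_id v).rpow_const (p := p) (.inl h.ne')
    refine (this.congr_of_eventuallyEq ?_).congr_deriv ?_
    · filter_upwards [eventually_gt_nhds h] with x hx
      rw [oddRpow, max_eq_left hx.le, max_eq_right (by linarith), Real.zero_rpow hp, sub_zero]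
      rfl
    · rw [abs_of_pos h]; simp

/-- If `F` were constant near `z(s₀)`, then `e^{iφ}` would be constant near `s₀`, contradicting
strict monotonicity of the continuous `φ`. So `F - F(z(s₀))` has a zero of finite order. -/
lemma exists_pow_mul_of_comp_eq_exp {lo hi s₀ : ℝ} (hlt : lo < hi) (hs₀ : s₀ ∈ Icc lo hi)
    {φ : ℝ → ℝ} (hφc : ContinuousOn φ (Icc lo hi)) (hφm : StrictMonoOn φ (Icc lo hi))
    {z : ℝ → ℂ} (hz : ContinuousWithinAt z (Icc lo hi) s₀) {F : ℂ → ℂ}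
    (hF : AnalyticAt ℂ F (z s₀))
    (hFz : ∀ᶠ s in 𝓝[Icc lo hi] s₀, F (z s) = Complex.exp (φ s * Complex.I)) :
    ∃ (k : ℕ) (G : ℂ → ℂ), k ≠ 0 ∧ AnalyticAt ℂ G (z s₀) ∧ G (z s₀) ≠ 0 ∧
      ∀ᶠ t in 𝓝 (z s₀), F t - F (z s₀) = (t - z s₀) ^ k * G t := by
  have hF' : AnalyticAt ℂ (fun t => F t - F (z s₀)) (z s₀) := hF.sub analyticAt_const
  have hne : ¬ ∀ᶠ t in 𝓝 (z s₀), F t - F (z s₀) = 0 := by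
    intro hc
    have h1 : ∀ᶠ s in 𝓝[Icc lo hi] s₀, F (z s) - F (z s₀) = 0 := hz.eventually hc
    have hclose : ∀ᶠ s in 𝓝[Icc lo hi] s₀, φ s ∈ Metric.ball (φ s₀) Real.pi :=
      (hφc s₀ hs₀).eventually (Metric.ball_mem_nhds _ Real.pi_pos)
    have hs0 := hFz.self_of_nhdsWithin hs₀
    have h2 : ∀ᶠ s in 𝓝[Icc lo hi] s₀, s = s₀ := by
      filter_upwards [h1, hclose, hFz, self_mem_nhdsWithin] with s h hd hs hm
      rw [hs, hs0, sub_eq_zero, Complex.exp_eq_exp_iff_exists_int] at h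
      obtain ⟨n, hn⟩ := h
      have hn' : φ s = φ s₀ + n * (2 * Real.pi) := by
        have := congrArg Complex.im hn
        simpa using this
      refine hφm.injOn hm hs₀ ?_
      rw [Metric.mem_ball, hn', Real.dist_eq, add_sub_cancel_left, abs_mul,
        abs_of_pos Real.two_pi_pos] at hd
      have : |(n : ℝ)| < 1 := by nlinarith [Real.pi_pos]
      have : n = 0 := by
        rw [← Int.abs_lt_one_iff]
        exact_mod_cast this
      rw [hn', this]
      simp
    have hacc : (𝓝[Icc lo hi \ {s₀}] s₀).NeBot := by
      rw [← mem_closure_iff_nhdsWithin_neBot]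
      have h3 : Ioo lo hi \ {s₀} ⊆ Icc lo hi \ {s₀} := sdiff_subset_sdiff_left Ioo_subset_Icc_self
      refine closure_mono h3 ?_
      have h4 : Dense ({s₀}ᶜ : Set ℝ) := dense_compl_singleton s₀
      have h5 := h4.open_subset_closure_inter (isOpen_Ioo (a := lo) (b := hi))
      have h6 := closure_minimal h5 isClosed_closure
      rw [closure_Ioo hlt.ne] at h6
      exact h6 hs₀
    have h3 : ∀ᶠ s in 𝓝[Icc lo hi \ {s₀}] s₀, False := by
      filter_upwards [nhdsWithin_mono _ sdiff_subset h2, self_mem_nhdsWithin] with s hs hm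
      exact hm.2 hs
    exact h3.exists.elim fun _ h => h
  obtain ⟨k, G, hG, hG0, hev⟩ := hF'.exists_eventuallyEq_pow_smul_nonzero_iff.2 hne
  refine ⟨k, G, ?_, hG, hG0, hev⟩
  rintro rfl
  have := hev.self_of_nhds
  simp at this
  exact hG0 this.symm

/-- Put `v = φ - φ₀` and `q = z'/(z - t₀)`. Logarithmic differentiation of `heq` gives `k q + (g'/g)
z' = φ' ζ` with `ζ = i e^{iv}/(e^{iv} - 1)`. Since `|ζ| ≤ 2/|v|` and `|z - t₀|` is `O(|v|^{1/k})`,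
the speed is `O(φ' |v|^{1/k - 1})`. For the imaginary part, `Im ζ = 1/2` removes the pole. -/
lemma norm_deriv_le_of_pow_mul_eq {k : ℕ} (hk : k ≠ 0) {t₀ z z' g g' : ℂ} {φ φ₀ φ' C₁ C₂ : ℝ}
    (hφ' : 0 ≤ φ') (hv0 : φ - φ₀ ≠ 0) (hv1 : |φ - φ₀| ≤ 1) (hC₂ : 0 ≤ C₂)
    (hg : g ≠ 0) (hg1 : ‖g' / g‖ ≤ C₁) (hg2 : ‖g‖⁻¹ ≤ C₂) (hz1 : ‖z - t₀‖ * C₁ ≤ 1 / 2)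
    (heq : Complex.exp (φ * Complex.I) - Complex.exp (φ₀ * Complex.I) = (z - t₀) ^ k * g)
    (hder : k * (z - t₀) ^ (k - 1) * z' * g + (z - t₀) ^ k * (g' * z') =
      Complex.exp (φ * Complex.I) * (φ' * Complex.I)) :
    ‖z'‖ ≤ 4 * C₂ ^ ((1 : ℝ) / k) * (φ' * |φ - φ₀| ^ ((1 : ℝ) / k - 1)) ∧
      |(z' / (z - t₀)).im| ≤ φ' + C₁ * ‖z'‖ := by
  set v := φ - φ₀ with hv
  have hvpos : 0 < |v| := abs_pos.2 hv0
  have hexp : Complex.exp (φ * Complex.I) =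
      Complex.exp (φ₀ * Complex.I) * Complex.exp (v * Complex.I) := by
    rw [← Complex.exp_add, hv]; push_cast; ring_nf
  have hE0 : Complex.exp (φ₀ * Complex.I) ≠ 0 := Complex.exp_ne_zero _
  have hsub : Complex.exp (φ * Complex.I) - Complex.exp (φ₀ * Complex.I) =
      Complex.exp (φ₀ * Complex.I) * (Complex.exp (v * Complex.I) - 1) := by rw [hexp]; ring
  have hlow := half_abs_le_norm_exp_mul_I_sub_one hv1
  have hlowpos : 0 < ‖Complex.exp (v * Complex.I) - 1‖ := by linarith
  have hne1 : Complex.exp (v * Complex.I) - 1 ≠ 0 := norm_pos_iff.1 hlowpos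
  have hzt : z - t₀ ≠ 0 := by
    intro h
    rw [h, zero_pow hk, zero_mul, hsub] at heq
    exact mul_ne_zero hE0 hne1 heq
  set ζ := Complex.I * Complex.exp (v * Complex.I) / (Complex.exp (v * Complex.I) - 1) with hζ
  set q := z' / (z - t₀) with hq
  have hz' : z' = q * (z - t₀) := by rw [hq]; field_simp
  have hqeq : q * (k + (z - t₀) * (g' / g)) = φ' * ζ := by
    have hpow : (z - t₀) ^ k = (z - t₀) ^ (k - 1) * (z - t₀) := by
      rw [← pow_succ, Nat.sub_add_cancel (Nat.pos_of_ne_zero hk)]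
    have h1 : (z - t₀) ^ k * g * (q * (k + (z - t₀) * (g' / g))) =
        Complex.exp (φ * Complex.I) * (φ' * Complex.I) := by
      rw [← hder, hz', hpow]
      field_simp
    rw [← heq, hsub, hexp] at h1
    have h2 := mul_left_cancel₀ hE0 (by linear_combination h1 :
      Complex.exp (φ₀ * Complex.I) * ((Complex.exp (v * Complex.I) - 1) *
        (q * (k + (z - t₀) * (g' / g)))) =
      Complex.exp (φ₀ * Complex.I) * (Complex.exp (v * Complex.I) * (φ' * Complex.I)))
    have h3 : (φ' : ℂ) * ζ = φ' * (Complex.I * Complex.exp (v * Complex.I)) /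
        (Complex.exp (v * Complex.I) - 1) := by rw [hζ]; ring
    rw [h3, eq_div_iff hne1]
    linear_combination h2
  have hk1 : (1 : ℝ) ≤ k := by exact_mod_cast Nat.one_le_iff_ne_zero.2 hk
  have hM : ‖(z - t₀) * (g' / g)‖ ≤ 1 / 2 := by
    rw [norm_mul]
    exact (mul_le_mul_of_nonneg_left hg1 (norm_nonneg _)).trans hz1
  have hden : 1 / 2 ≤ ‖(k : ℂ) + (z - t₀) * (g' / g)‖ := by
    have h1 := norm_sub_norm_le (k : ℂ) (-((z - t₀) * (g' / g)))
    rw [sub_neg_eq_add, norm_neg, Complex.norm_natCast] at h1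
    linarith
  have hζn : ‖ζ‖ ≤ 2 / |v| := by
    rw [hζ, norm_div, norm_mul, Complex.norm_I, Complex.norm_exp_ofReal_mul_I, one_mul,
      div_le_div_iff₀ hlowpos hvpos]
    linarith
  have hqn : ‖q‖ ≤ φ' * (4 / |v|) := by
    have h1 := congrArg norm hqeq
    rw [norm_mul, norm_mul, Complex.norm_real, Real.norm_of_nonneg hφ'] at h1
    have h2 : ‖q‖ * (1 / 2) ≤ φ' * (2 / |v|) := calc
      _ ≤ ‖q‖ * ‖(k : ℂ) + (z - t₀) * (g' / g)‖ := by gcongr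
      _ = φ' * ‖ζ‖ := h1
      _ ≤ _ := by gcongr
    calc ‖q‖ = 2 * (‖q‖ * (1 / 2)) := by ring
      _ ≤ 2 * (φ' * (2 / |v|)) := by gcongr
      _ = _ := by ring
  have hztn : ‖z - t₀‖ ≤ C₂ ^ ((1 : ℝ) / k) * |v| ^ ((1 : ℝ) / k) := by
    have h1 : ‖z - t₀‖ ^ k ≤ C₂ * |v| := by
      have h2 := congrArg norm (heq.symm.trans hsub)
      rw [norm_mul, norm_mul, norm_pow, Complex.norm_exp_ofReal_mul_I, one_mul] at h2
      have h3 : ‖Complex.exp (v * Complex.I) - 1‖ ≤ |v| := by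
        rw [mul_comm]
        simpa using Real.norm_exp_I_mul_ofReal_sub_one_le (x := v)
      have hg' : 0 < ‖g‖ := norm_pos_iff.2 hg
      calc ‖z - t₀‖ ^ k = ‖g‖⁻¹ * (‖z - t₀‖ ^ k * ‖g‖) := by field_simp
        _ ≤ C₂ * |v| := by rw [h2]; gcongr
    rw [← Real.mul_rpow hC₂ hvpos.le]
    calc ‖z - t₀‖ = (‖z - t₀‖ ^ k) ^ ((1 : ℝ) / k) := by
          rw [one_div, Real.pow_rpow_inv_natCast (norm_nonneg _) hk]
      _ ≤ _ := by gcongr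
  constructor
  · rw [hz', norm_mul, Real.rpow_sub_one hvpos.ne']
    calc ‖q‖ * ‖z - t₀‖ ≤ φ' * (4 / |v|) * (C₂ ^ ((1 : ℝ) / k) * |v| ^ ((1 : ℝ) / k)) := by gcongr
      _ = _ := by ring
  · have h1 : (k : ℂ) * q = φ' * ζ - g' / g * z' := by
      rw [← hqeq, hz']; ring
    have h2 := congrArg Complex.im h1
    have h3 : (k : ℝ) * q.im = φ' * (1 / 2) - (g' / g * z').im := by
      rw [← im_I_mul_exp_div hne1, ← hζ]
      simpa [Complex.mul_im] using h2
    have h4 : |(g' / g * z').im| ≤ C₁ * ‖z'‖ := by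
      refine (Complex.abs_im_le_norm _).trans ?_
      rw [norm_mul]
      gcongr
    calc |q.im| ≤ k * |q.im| := le_mul_of_one_le_left (abs_nonneg _) hk1
      _ = |k * q.im| := by rw [abs_mul, Nat.abs_cast]
      _ ≤ |φ' * (1 / 2)| + |(g' / g * z').im| := by rw [h3]; exact abs_sub _ _
      _ ≤ _ := by
        rw [abs_of_nonneg (by positivity)]
        linarith

/-- The bounds `φ'` and `φ' |φ - φ(s₀)|^{1/k - 1}` are, up to constants, derivatives of monotone
functions of `s`: `φ` itself and an odd power of `φ - φ(s₀)`. Nothing about absolute continuity of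
`φ` is needed. -/
lemma exists_monotoneOn_bound_deriv {lo hi s₀ : ℝ} (hlt : lo < hi) (hs₀ : s₀ ∈ Icc lo hi)
    {φ : ℝ → ℝ} (hφc : ContinuousOn φ (Icc lo hi)) (hφm : StrictMonoOn φ (Icc lo hi))
    {E : Set ℝ} (hφd : ∀ s ∈ Ioo lo hi \ E, DifferentiableAt ℝ φ s)
    {z : ℝ → ℂ} (hz : ContinuousWithinAt z (Icc lo hi) s₀)
    (hzd : ∀ᶠ s in 𝓝[Icc lo hi] s₀, s ∈ Ioo lo hi \ E → s ≠ s₀ → DifferentiableAt ℝ z s)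
    {F : ℂ → ℂ} (hF : AnalyticAt ℂ F (z s₀))
    (hFz : ∀ᶠ s in 𝓝[Icc lo hi] s₀, F (z s) = Complex.exp (φ s * Complex.I)) :
    ∃ W : ℝ → ℝ, MonotoneOn W (Icc lo hi) ∧ ∀ᶠ s in 𝓝[Icc lo hi] s₀,
      s ∈ Ioo lo hi \ E → s ≠ s₀ →
        ‖deriv z s‖ ≤ deriv W s ∧ |(deriv z s / (z s - z s₀)).im| ≤ deriv W s := by
  obtain ⟨k, G, hk, hG, hG0, hFG⟩ :=
    exists_pow_mul_of_comp_eq_exp hlt hs₀ hφc hφm hz hF hFz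
  set t₀ := z s₀ with ht₀
  set C₁ := ‖deriv G t₀ / G t₀‖ + 1 with hC₁
  set C₂ := ‖G t₀‖⁻¹ + 1 with hC₂
  have hC₁0 : 0 ≤ C₁ := by positivity
  have hC₂0 : 0 ≤ C₂ := by positivity
  have hk0 : (0 : ℝ) < 1 / k := by
    have : (0 : ℝ) < k := by exact_mod_cast Nat.pos_of_ne_zero hk
    positivity
  have hg : ∀ᶠ t in 𝓝 t₀, G t ≠ 0 := hG.continuousAt.eventually_ne hG0
  have hg1 : ∀ᶠ t in 𝓝 t₀, ‖deriv G t / G t‖ ≤ C₁ := by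
    have hc : ContinuousAt (fun t => ‖deriv G t / G t‖) t₀ :=
      (hG.deriv.continuousAt.div hG.continuousAt hG0).norm
    exact (hc.eventually_lt continuousAt_const (lt_add_one _)).mono fun _ h => h.le
  have hg2 : ∀ᶠ t in 𝓝 t₀, ‖G t‖⁻¹ ≤ C₂ := by
    have hc : ContinuousAt (fun t => ‖G t‖⁻¹) t₀ :=
      hG.continuousAt.norm.inv₀ (norm_ne_zero_iff.2 hG0)
    exact (hc.eventually_lt continuousAt_const (lt_add_one _)).mono fun _ h => h.le
  have hz1 : ∀ᶠ t in 𝓝 t₀, ‖t - t₀‖ * C₁ ≤ 1 / 2 := by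
    have hc : ContinuousAt (fun t => ‖t - t₀‖ * C₁) t₀ := by fun_prop
    exact (hc.eventually_lt (g := fun _ => (1 / 2 : ℝ)) continuousAt_const
      (by simp)).mono fun _ h => h.le
  have hclose : ∀ᶠ s in 𝓝[Icc lo hi] s₀, |φ s - φ s₀| ≤ 1 := by
    have := (hφc s₀ hs₀).eventually (Metric.ball_mem_nhds (φ s₀) one_pos)
    exact this.mono fun s hs => (Metric.mem_ball.1 hs).le
  have hs0 := hFz.self_of_nhdsWithin hs₀
  have hev : ∀ᶠ s in 𝓝[Icc lo hi] s₀, Complex.exp (φ s * Complex.I) -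
      Complex.exp (φ s₀ * Complex.I) = (z s - t₀) ^ k * G (z s) := by
    filter_upwards [hz.eventually hFG, hFz] with s h1 h2
    rw [← h1, h2, ht₀, hs0]
  set D := 4 * C₂ ^ ((1 : ℝ) / k) with hD
  have hD0 : 0 ≤ D := by positivity
  set w : ℝ → ℝ := fun s => oddRpow (1 / k) (φ s - φ s₀) with hw
  have hwm : MonotoneOn w (Icc lo hi) := fun x hx y hy hxy =>
    monotone_oddRpow hk0.le (sub_le_sub_right (hφm.monotoneOn hx hy hxy) _)
  -- The factor `k` undoes the `1/k` from differentiating the power, and `1 + C₁` covers both `‖z'‖`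
  -- and `C₁‖z'‖`.
  refine ⟨fun s => φ s + (1 + C₁) * D * k * w s, ?_, ?_⟩
  · intro x hx y hy hxy
    have h1 := hφm.monotoneOn hx hy hxy
    have h2 := hwm hx hy hxy
    simp only
    gcongr
  filter_upwards [hz.eventually hg, hz.eventually hg1, hz.eventually hg2, hz.eventually hz1,
    hclose, hzd, eventually_eventually_nhdsWithin.2 hev,
    hz.eventually hG.eventually_analyticAt] with s a1 a2 a3 a4 a5 a6 a7 a8 hs hne
  have hsI : Icc lo hi ∈ 𝓝 s := Icc_mem_nhds hs.1.1 hs.1.2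
  rw [nhdsWithin_eq_nhds.2 hsI] at a7
  have hdz := (a6 hs hne).hasDerivAt
  have hdφ := (hφd s hs).hasDerivAt
  have hφ0 : 0 ≤ deriv φ s := by
    rw [← derivWithin_of_mem_nhds hsI]
    exact hφm.monotoneOn.derivWithin_nonneg
  have hv0 : φ s - φ s₀ ≠ 0 := sub_ne_zero.2 fun h =>
    hne (hφm.injOn (Ioo_subset_Icc_self hs.1) hs₀ h)
  have hL : HasDerivAt (fun s => Complex.exp (φ s * Complex.I) - Complex.exp (φ s₀ * Complex.I))
      (Complex.exp (φ s * Complex.I) * (deriv φ s * Complex.I)) s :=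
    ((hdφ.ofReal_comp.mul_const Complex.I).cexp).sub_const _
  have hR : HasDerivAt (fun s => (z s - t₀) ^ k * G (z s))
      (k * (z s - t₀) ^ (k - 1) * deriv z s * G (z s) +
        (z s - t₀) ^ k * (deriv G (z s) * deriv z s)) s :=
    ((hdz.sub_const t₀).pow k).mul (a8.differentiableAt.hasDerivAt.comp s hdz)
  obtain ⟨b1, b2⟩ := norm_deriv_le_of_pow_mul_eq hk hφ0 hv0 a5 hC₂0 a1 a2 a3 a4
    a7.self_of_nhds (hR.unique (hL.congr_of_eventuallyEq (a7.mono fun _ h => h.symm)))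
  have hdw : HasDerivAt w (1 / k * |φ s - φ s₀| ^ ((1 : ℝ) / k - 1) * deriv φ s) s :=
    HasDerivAt.comp (h₂ := oddRpow (1 / k)) (h := fun s => φ s - φ s₀) s
      (hasDerivAt_oddRpow hk0.ne' hv0) (hdφ.sub_const _)
  have hdW : deriv (fun s => φ s + (1 + C₁) * D * k * w s) s =
      deriv φ s + (1 + C₁) * (D * (deriv φ s * |φ s - φ s₀| ^ ((1 : ℝ) / k - 1))) := by
    refine (hdφ.add (hdw.const_mul _)).deriv.trans ?_
    have : (k : ℝ) ≠ 0 := by exact_mod_cast hk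
    field_simp
  set B := D * (deriv φ s * |φ s - φ s₀| ^ ((1 : ℝ) / k - 1)) with hB
  have hB0 : 0 ≤ B := by positivity
  rw [hdW]
  constructor
  · nlinarith [mul_nonneg hC₁0 hB0]
  · nlinarith [mul_le_mul_of_nonneg_left b1 hC₁0]

/-! ### Values of factored rational functions -/

/-- The function `t ↦ c ∏ᵢ (t - ρᵢ)^{eᵢ}` on `ℂ`. -/
noncomputable def prodZpow {k : ℕ} (c : ℂ) (ρ : Fin k → ℂ) (e : Fin k → ℤ) (t : ℂ) : ℂ :=
  c * ∏ i, (t - ρ i) ^ e i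

section Factored

variable {k : ℕ} {c : ℂ} {ρ : Fin k → ℂ} {e : Fin k → ℤ}

/-- The reduced numerator and denominator are not computed. Values and degrees of the rational
function are read off this identity, in which positive and negative exponents are separated. -/
lemma factored_num_mul (c : ℂ) (ρ : Fin k → ℂ) (e : Fin k → ℤ) :
    (factored c ρ e).num * ∏ i, (Polynomial.X - Polynomial.C (ρ i)) ^ (-e i).toNat =
      (factored c ρ e).denom *
        (Polynomial.C c * ∏ i, (Polynomial.X - Polynomial.C (ρ i)) ^ (e i).toNat) := by
  have hX (i : Fin k) : (RatFunc.X - RatFunc.C (ρ i) : RatFunc ℂ) ≠ 0 := by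
    rw [← RatFunc.algebraMap_X, ← RatFunc.algebraMap_C, ← map_sub]
    exact (map_ne_zero_iff _ (RatFunc.algebraMap_injective ℂ)).2 (Polynomial.X_sub_C_ne_zero _)
  have h1 : factored c ρ e * ∏ i, (RatFunc.X - RatFunc.C (ρ i)) ^ (-e i).toNat =
      RatFunc.C c * ∏ i, (RatFunc.X - RatFunc.C (ρ i)) ^ (e i).toNat := by
    rw [factored, mul_assoc, ← Finset.prod_mul_distrib]
    congr 1
    refine Finset.prod_congr rfl fun i _ => ?_
    rw [← zpow_natCast, ← zpow_natCast, ← zpow_add₀ (hX i)]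
    congr 1
    have := Int.toNat_sub_toNat_neg (e i)
    omega
  have h2 : algebraMap ℂ[X] (RatFunc ℂ) (factored c ρ e).denom ≠ 0 :=
    RatFunc.algebraMap_ne_zero (RatFunc.denom_ne_zero _)
  have h3 := RatFunc.num_div_denom (factored c ρ e)
  rw [div_eq_iff h2] at h3
  refine RatFunc.algebraMap_injective ℂ ?_
  simp only [map_mul, map_prod, map_pow, map_sub, RatFunc.algebraMap_X, RatFunc.algebraMap_C]
  rw [h3, ← h1]
  ring

lemma eval_factored_num_mul (c : ℂ) (ρ : Fin k → ℂ) (e : Fin k → ℤ) (t : ℂ) :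
    (factored c ρ e).num.eval t * ∏ i, (t - ρ i) ^ (-e i).toNat =
      (factored c ρ e).denom.eval t * (c * ∏ i, (t - ρ i) ^ (e i).toNat) := by
  have := congrArg (Polynomial.eval t) (factored_num_mul c ρ e)
  simpa [Polynomial.eval_prod] using this

lemma eval_num_ne_zero_of_eval_denom_eq_zero (f : RatFunc ℂ) {t : ℂ} (h : f.denom.eval t = 0) :
    f.num.eval t ≠ 0 := by
  intro h0
  obtain ⟨a, b, hab⟩ := f.isCoprime_num_denom
  have := congrArg (Polynomial.eval t) hab
  simp [h, h0] at this

lemma evalP1_factored_of_ne {t : ℂ} (ht : ∀ i, t ≠ ρ i) :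
    evalP1 (factored c ρ e) t = (prodZpow c ρ e t : OnePoint ℂ) := by
  have h := eval_factored_num_mul c ρ e t
  have hp (n : Fin k → ℕ) : ∏ i, (t - ρ i) ^ n i ≠ 0 :=
    Finset.prod_ne_zero_iff.2 fun i _ => pow_ne_zero _ (sub_ne_zero.2 (ht i))
  have hd : (factored c ρ e).denom.eval t ≠ 0 := by
    intro hd
    rw [hd, zero_mul] at h
    exact mul_ne_zero (eval_num_ne_zero_of_eval_denom_eq_zero _ hd) (hp _) h
  simp only [evalP1, OnePoint.elim_some]
  rw [if_neg hd]
  congr 1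
  have h2 : ∏ i, (t - ρ i) ^ e i =
      (∏ i, (t - ρ i) ^ (e i).toNat) / ∏ i, (t - ρ i) ^ (-e i).toNat := by
    rw [← Finset.prod_div_distrib]
    refine Finset.prod_congr rfl fun i _ => ?_
    rw [← zpow_natCast, ← zpow_natCast, ← zpow_sub₀ (sub_ne_zero.2 (ht i)),
      Int.toNat_sub_toNat_neg]
  rw [prodZpow, h2, div_eq_iff hd, ← mul_div_assoc, div_mul_eq_mul_div, eq_div_iff (hp _), h]
  ring

/-- With distinct roots and nonzero exponents the value at a root is `0` or `∞`, so a path over the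
unit circle never meets an `α_r`. -/
lemma ne_of_evalP1_factored (hρ : Function.Injective ρ) (he : ∀ i, e i ≠ 0) {t x : ℂ}
    (hx : x ≠ 0) (h : evalP1 (factored c ρ e) t = (x : OnePoint ℂ)) (i : Fin k) : t ≠ ρ i := by
  rintro rfl
  have hid := eval_factored_num_mul c ρ e (ρ i)
  simp only [evalP1, OnePoint.elim_some] at h
  split_ifs at h with hd
  · exact absurd h (OnePoint.infty_ne_coe x)
  rw [OnePoint.coe_eq_coe] at h
  have hc : c ≠ 0 := by
    rintro rfl
    apply hx
    rw [← h]
    simp [factored]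
  have hzero (n : Fin k → ℕ) (hn : n i ≠ 0) : ∏ j, (ρ i - ρ j) ^ n j = 0 :=
    Finset.prod_eq_zero (Finset.mem_univ i) (by simp [hn])
  have hnz (n : Fin k → ℕ) (hn : n i = 0) : ∏ j, (ρ i - ρ j) ^ n j ≠ 0 := by
    refine Finset.prod_ne_zero_iff.2 fun j _ => ?_
    by_cases hj : j = i
    · subst hj; simp [hn]
    · exact pow_ne_zero _ (sub_ne_zero.2 fun hh => hj (hρ hh).symm)
  rcases lt_or_gt_of_ne (he i) with hneg | hpos
  · rw [hzero (fun j => (-e j).toNat) (by simp; omega), mul_zero] at hid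
    exact mul_ne_zero hd (mul_ne_zero hc (hnz (fun j => (e j).toNat) (by simp; omega))) hid.symm
  · rw [hzero (fun j => (e j).toNat) (by simp; omega), mul_zero, mul_zero] at hid
    rcases mul_eq_zero.1 hid with h0 | h0
    · exact hx (by rw [← h, h0, zero_div])
    · exact hnz (fun j => (-e j).toNat) (by simp; omega) h0

lemma evalP1_factored_infty {x : ℂ} (hx : x ≠ 0)
    (h : evalP1 (factored c ρ e) OnePoint.infty = (x : OnePoint ℂ)) :
    ∑ i, e i = 0 ∧ c = x := by
  have hid := factored_num_mul c ρ e
  simp only [evalP1, OnePoint.elim_infty] at h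
  split_ifs at h with hd
  · exact absurd h (OnePoint.infty_ne_coe x)
  rw [OnePoint.coe_eq_coe] at h
  set f := factored c ρ e with hf
  have hlc : f.denom.leadingCoeff = 1 := RatFunc.monic_denom f
  rw [hlc, div_one] at h
  have hc : c ≠ 0 := by
    rintro rfl
    apply hx
    rw [← h, hf]
    simp [factored]
  have hdeg : f.num.natDegree = f.denom.natDegree :=
    le_antisymm (not_lt.1 hd) (Polynomial.le_natDegree_of_ne_zero (by rw [h]; exact hx))
  have hmon (n : Fin k → ℕ) : (∏ i, (Polynomial.X - Polynomial.C (ρ i)) ^ n i).Monic :=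
    Polynomial.monic_prod_of_monic _ _ fun i _ => (Polynomial.monic_X_sub_C _).pow _
  have hnd (n : Fin k → ℕ) :
      (∏ i, (Polynomial.X - Polynomial.C (ρ i)) ^ n i).natDegree = ∑ i, n i := by
    rw [Polynomial.natDegree_prod_of_monic _ _ fun i _ => (Polynomial.monic_X_sub_C _).pow _]
    simp
  have hnum0 : f.num ≠ 0 := by
    intro h0
    rw [h0] at h
    exact hx (by simpa using h.symm)
  constructor
  · have h1 := congrArg Polynomial.natDegree hid
    rw [Polynomial.natDegree_mul hnum0 (hmon _).ne_zero, Polynomial.natDegree_mul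
      (RatFunc.denom_ne_zero _) (mul_ne_zero (Polynomial.C_ne_zero.2 hc) (hmon _).ne_zero),
      Polynomial.natDegree_C_mul hc, hnd, hnd, hdeg, Nat.add_left_cancel_iff] at h1
    have h2 : ∑ i, e i = ((∑ i, (e i).toNat : ℕ) : ℤ) - ((∑ i, (-e i).toNat : ℕ) : ℤ) := by
      push_cast
      rw [← Finset.sum_sub_distrib]
      exact Finset.sum_congr rfl fun i _ => (Int.toNat_sub_toNat_neg _).symm
    rw [h2, h1, sub_self]
  · have h1 := congrArg Polynomial.leadingCoeff hid
    rw [Polynomial.leadingCoeff_mul, Polynomial.leadingCoeff_mul, Polynomial.leadingCoeff_mul,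
      hmon, hmon, hlc, Polynomial.leadingCoeff_C, Polynomial.leadingCoeff, hdeg, h] at h1
    simpa using h1.symm

lemma analyticAt_prodZpow {t : ℂ} (ht : ∀ i, t ≠ ρ i) : AnalyticAt ℂ (prodZpow c ρ e) t := by
  unfold prodZpow
  refine analyticAt_const.mul (Finset.analyticAt_fun_prod _ fun i _ => ?_)
  exact (analyticAt_id.sub analyticAt_const).fun_zpow (sub_ne_zero.2 (ht i))

lemma analyticAt_prod_one_sub_mul_zpow :
    AnalyticAt ℂ (fun w => c * ∏ i, (1 - ρ i * w) ^ e i) 0 := by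
  refine analyticAt_const.mul (Finset.analyticAt_fun_prod _ fun i _ => ?_)
  exact (analyticAt_const.sub (analyticAt_const.mul analyticAt_id)).fun_zpow (by simp)

/-- In total degree zero this expresses the function in the coordinate `w = 1/t` at infinity, where
it is analytic. -/
lemma prod_one_sub_mul_inv_zpow (he : ∑ i, e i = 0) {t : ℂ} (ht : t ≠ 0) :
    c * ∏ i, (1 - ρ i * t⁻¹) ^ e i = prodZpow c ρ e t := by
  have h1 : ∏ i, (1 - ρ i * t⁻¹) ^ e i = (∏ i, (t - ρ i) ^ e i) / ∏ i, t ^ e i := by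
    rw [← Finset.prod_div_distrib]
    refine Finset.prod_congr rfl fun i _ => ?_
    rw [← div_zpow]
    congr 1
    field_simp
  have h2 : ∏ i, t ^ e i = 1 := by
    have : ∀ s : Finset (Fin k), ∏ i ∈ s, t ^ e i = t ^ ∑ i ∈ s, e i := fun s => by
      induction s using Finset.induction_on with
      | empty => simp
      | insert a s ha ih => rw [Finset.prod_insert ha, Finset.sum_insert ha, zpow_add₀ ht, ih]
    rw [this, he, zpow_zero]
  rw [h1, h2, div_one, prodZpow]

lemma log_norm_prodZpow (hc : c ≠ 0) {t : ℂ} (ht : ∀ i, t ≠ ρ i) :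
    Real.log ‖prodZpow c ρ e t‖ = Real.log ‖c‖ + ∑ i, (e i : ℝ) * Real.log ‖t - ρ i‖ := by
  have hne (i : Fin k) : ‖t - ρ i‖ ^ e i ≠ 0 :=
    zpow_ne_zero _ (norm_ne_zero_iff.2 (sub_ne_zero.2 (ht i)))
  rw [prodZpow, norm_mul, norm_prod, Real.log_mul (norm_ne_zero_iff.2 hc)
    (Finset.prod_ne_zero_iff.2 fun i _ => by rw [norm_zpow]; exact hne i)]
  congr 1
  rw [Real.log_prod (fun i _ => by rw [norm_zpow]; exact hne i)]
  exact Finset.sum_congr rfl fun i _ => by rw [norm_zpow, Real.log_zpow]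

open Classical in
lemma log_norm_tildeEval (hc : c ≠ 0) (t : ℂ) :
    Real.log ‖tildeEval c ρ e t‖ =
      Real.log ‖c‖ + ∑ i, if ρ i = t then 0 else (e i : ℝ) * Real.log ‖t - ρ i‖ := by
  have hne (i) (hi : i ∈ Finset.univ.filter fun i => ρ i ≠ t) : ‖(t - ρ i) ^ e i‖ ≠ 0 := by
    rw [norm_zpow]
    exact zpow_ne_zero _ (norm_ne_zero_iff.2 (sub_ne_zero.2 (Finset.mem_filter.1 hi).2.symm))
  have h1 : Real.log ‖tildeEval c ρ e t‖ = Real.log ‖c‖ +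
      ∑ i ∈ Finset.univ.filter (fun i => ρ i ≠ t), (e i : ℝ) * Real.log ‖t - ρ i‖ := by
    rw [tildeEval, norm_mul, norm_prod, Real.log_mul (norm_ne_zero_iff.2 hc)
      (Finset.prod_ne_zero_iff.2 hne), Real.log_prod hne]
    congr 1
    exact Finset.sum_congr rfl fun i _ => by rw [norm_zpow, Real.log_zpow]
  rw [h1, Finset.sum_filter]
  congr 1
  exact Finset.sum_congr rfl fun i _ => by simp [ite_not]

lemma hasDerivAt_prodZpow_comp {z : ℝ → ℂ} {z' : ℂ} {s : ℝ} (hz : HasDerivAt z z' s)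
    (ht : ∀ i, z s ≠ ρ i) : HasDerivAt (fun s => prodZpow c ρ e (z s))
      (prodZpow c ρ e (z s) * ∑ i, (e i : ℂ) * (z' / (z s - ρ i))) s := by
  have h (i : Fin k) : HasDerivAt (fun x => (z x - ρ i) ^ e i)
      ((e i : ℂ) * (z s - ρ i) ^ (e i - 1) * z') s :=
    (hasDerivAt_zpow (e i) (z s - ρ i) (.inl (sub_ne_zero.2 (ht i)))).comp_of_eq s
      (hz.sub_const _) rfl
  have h2 := (HasDerivAt.fun_finsetProd (u := Finset.univ) fun i _ => h i).const_mul c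
  refine h2.congr_deriv ?_
  rw [prodZpow, mul_assoc]
  refine congrArg (c * ·) ?_
  rw [Finset.mul_sum]
  refine Finset.sum_congr rfl fun i hi => ?_
  rw [← Finset.mul_prod_erase _ _ hi, zpow_sub_one₀ (sub_ne_zero.2 (ht i)), smul_eq_mul]
  field_simp

end Factored

/-! ### Paths on which a factored function has absolute value one -/

/-- The derivative of a monotone function is integrable; local domination suffices by compactness.
-/
lemma intervalIntegrable_of_locally_le_deriv {lo hi : ℝ} (hlt : lo < hi) {A : Set ℝ}
    (hA : A =ᵐ[volume] Icc lo hi) {h : ℝ → ℝ}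
    (hm : AEStronglyMeasurable h (volume.restrict A))
    (hb : ∀ s₀ ∈ Icc lo hi, ∃ W : ℝ → ℝ, MonotoneOn W (Icc lo hi) ∧ ∃ C : ℝ,
      ∀ᶠ s in 𝓝[Icc lo hi] s₀, s ∈ A → s ≠ s₀ → |h s| ≤ C * deriv W s) :
    IntervalIntegrable h volume lo hi := by
  rw [intervalIntegrable_iff_integrableOn_Icc_of_le hlt.le]
  refine LocallyIntegrableOn.integrableOn_isCompact (fun s₀ hs₀ => ?_) isCompact_Icc
  obtain ⟨W, hW, C, hev⟩ := hb s₀ hs₀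
  obtain ⟨U, hU, hs₀U, hUs⟩ := mem_nhdsWithin.1 hev
  refine ⟨U ∩ Icc lo hi, mem_nhdsWithin.2 ⟨U, hU, hs₀U, subset_rfl⟩, ?_⟩
  have hWi : IntegrableOn (fun s => C * deriv W s) (Icc lo hi) := by
    have := MonotoneOn.intervalIntegrable_deriv (a := lo) (b := hi) (by rwa [uIcc_of_le hlt.le])
    rw [intervalIntegrable_iff_integrableOn_Icc_of_le hlt.le] at this
    exact this.const_mul C
  have hm' : AEStronglyMeasurable h (volume.restrict (Icc lo hi)) := by
    rwa [← Measure.restrict_congr_set hA]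
  refine Integrable.mono' (hWi.mono_set inter_subset_right)
    (hm'.mono_measure (Measure.restrict_mono inter_subset_right le_rfl)) ?_
  rw [ae_restrict_iff' (hU.measurableSet.inter measurableSet_Icc)]
  have h1 : ∀ᵐ s : ℝ, s ≠ s₀ := by simp [ae_iff]
  filter_upwards [h1, hA.mem_iff] with s hs hsA hmem
  exact hUs hmem (hsA.2 hmem.2) hs

lemma tendsto_finitePart_of_ne_infty {X : Type*} {l : Filter X} {u : X → OnePoint ℂ}
    {t : OnePoint ℂ} (h : Tendsto u l (𝓝 t)) (ht : t ≠ OnePoint.infty) :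
    Tendsto (fun x => finitePart (u x)) l (𝓝 (finitePart t)) := by
  obtain ⟨w, rfl⟩ := OnePoint.ne_infty_iff_exists.1 ht
  refine Tendsto.comp (ContinuousAt.tendsto ?_) h
  rw [OnePoint.continuousAt_coe]
  exact continuousAt_id

lemma tendsto_inv_finitePart_of_infty {X : Type*} {l : Filter X} {u : X → OnePoint ℂ}
    (h : Tendsto u l (𝓝 OnePoint.infty)) :
    Tendsto (fun x => (finitePart (u x))⁻¹) l (𝓝 0) := by
  have : ContinuousAt (fun t : OnePoint ℂ => (finitePart t)⁻¹) OnePoint.infty := by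
    rw [OnePoint.continuousAt_infty', coclosedCompact_eq_cocompact,
      ← Metric.cobounded_eq_cocompact]
    have h0 : (finitePart OnePoint.infty)⁻¹ = 0 := by simp [finitePart]
    rw [h0]
    exact tendsto_inv₀_cobounded
  have h0 : (finitePart OnePoint.infty)⁻¹ = 0 := by simp [finitePart]
  have h1 := this.tendsto.comp h
  rw [h0] at h1
  exact h1

lemma eventually_infty_or_one_lt {X : Type*} {l : Filter X} {u : X → OnePoint ℂ}
    (h : Tendsto u l (𝓝 OnePoint.infty)) :
    ∀ᶠ x in l, u x = OnePoint.infty ∨ 1 < ‖finitePart (u x)‖ := by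
  refine h.eventually (p := fun t => t = OnePoint.infty ∨ 1 < ‖finitePart t‖) ?_
  rw [OnePoint.nhds_infty_eq, eventually_sup, eventually_map, coclosedCompact_eq_cocompact]
  refine ⟨?_, by simp⟩
  rw [← Metric.cobounded_eq_cocompact]
  have := tendsto_norm_cobounded_atTop (E := ℂ)
  exact (this.eventually_gt_atTop 1).mono fun x hx => .inr hx

lemma coe_finitePart {t : OnePoint ℂ} (h : t ≠ OnePoint.infty) :
    (finitePart t : OnePoint ℂ) = t := by
  obtain ⟨w, rfl⟩ := OnePoint.ne_infty_iff_exists.1 h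
  rfl

/-- A path along which `c ∏ᵢ (t - ρᵢ)^{eᵢ}` moves strictly counterclockwise on the unit circle,
with a choice of the argument `φ` and of the exceptional set `E`. -/
structure LiftedPath {k : ℕ} (c : ℂ) (ρ : Fin k → ℂ) (e : Fin k → ℤ) (γ : SpherePath)
    (φ : ℝ → ℝ) (E : Set ℝ) : Prop where
  injective : Function.Injective ρ
  exponent_ne : ∀ i, e i ≠ 0
  finite : E.Finite
  ne_infty : ∀ s ∈ Ioo γ.lo γ.hi \ E, γ.toFun s ≠ OnePoint.infty
  differentiableAt : ∀ s ∈ Ioo γ.lo γ.hi \ E,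
    DifferentiableAt ℝ (fun s' => finitePart (γ.toFun s')) s
  continuousOn : ContinuousOn φ (Icc γ.lo γ.hi)
  strictMonoOn : StrictMonoOn φ (Icc γ.lo γ.hi)
  eval_eq : ∀ s ∈ Icc γ.lo γ.hi, evalP1 (factored c ρ e) (γ.toFun s) =
    ((Complex.exp (φ s * Complex.I) : ℂ) : OnePoint ℂ)

namespace LiftedPath

variable {k : ℕ} {c : ℂ} {ρ : Fin k → ℂ} {e : Fin k → ℤ} {γ : SpherePath} {φ : ℝ → ℝ} {E : Set ℝ}

lemma ae_eq (h : LiftedPath c ρ e γ φ E) : Ioo γ.lo γ.hi \ E =ᵐ[volume] Icc γ.lo γ.hi :=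
  (sdiff_null_ae_eq_self (h.finite.measure_zero _)).trans Ioo_ae_eq_Icc

lemma ne_root (h : LiftedPath c ρ e γ φ E) {s : ℝ} (hs : s ∈ Icc γ.lo γ.hi)
    (hi : γ.toFun s ≠ OnePoint.infty) (i : Fin k) : finitePart (γ.toFun s) ≠ ρ i :=
  ne_of_evalP1_factored h.injective h.exponent_ne (Complex.exp_ne_zero _)
    (by rw [coe_finitePart hi]; exact h.eval_eq s hs) i

lemma prodZpow_eq (h : LiftedPath c ρ e γ φ E) {s : ℝ} (hs : s ∈ Icc γ.lo γ.hi)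
    (hi : γ.toFun s ≠ OnePoint.infty) :
    prodZpow c ρ e (finitePart (γ.toFun s)) = Complex.exp (φ s * Complex.I) := by
  have h1 := h.eval_eq s hs
  rw [← coe_finitePart hi, evalP1_factored_of_ne (h.ne_root hs hi)] at h1
  exact OnePoint.coe_eq_coe.1 h1

lemma eventually_mem (h : LiftedPath c ρ e γ φ E) {s : ℝ} (hs : s ∈ Ioo γ.lo γ.hi \ E) :
    ∀ᶠ x in 𝓝 s, x ∈ Ioo γ.lo γ.hi \ E :=
  (isOpen_Ioo.sdiff h.finite.isClosed).mem_nhds hs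

lemma hasDerivAt_arg (h : LiftedPath c ρ e γ φ E) {s : ℝ} (hs : s ∈ Ioo γ.lo γ.hi \ E) :
    HasDerivAt φ (∑ i, (e i : ℝ) * (deriv (fun s' => finitePart (γ.toFun s')) s /
      (finitePart (γ.toFun s) - ρ i)).im) s := by
  have hsI := Ioo_subset_Icc_self hs.1
  have hd := hasDerivAt_prodZpow_comp (c := c) (e := e) (h.differentiableAt s hs).hasDerivAt
    (h.ne_root hsI (h.ne_infty s hs))
  refine (hasDerivAt_of_exp_mul_I hd (h.continuousOn.continuousAt (Icc_mem_nhds hs.1.1 hs.1.2))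
    ?_).congr_deriv ?_
  · filter_upwards [h.eventually_mem hs] with x hx
    exact h.prodZpow_eq (Ioo_subset_Icc_self hx.1) (h.ne_infty x hx)
  · rw [mul_div_cancel_left₀ _ (by
      rw [h.prodZpow_eq hsI (h.ne_infty s hs)]; exact Complex.exp_ne_zero _), Complex.im_sum]
    refine Finset.sum_congr rfl fun i _ => ?_
    rw [← Complex.ofReal_intCast, Complex.im_ofReal_mul]

lemma aestronglyMeasurable_finitePart (h : LiftedPath c ρ e γ φ E) :
    AEStronglyMeasurable (fun s => finitePart (γ.toFun s))
      (volume.restrict (Ioo γ.lo γ.hi \ E)) := by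
  refine ContinuousOn.aestronglyMeasurable (fun s hs => ?_)
    (measurableSet_Ioo.diff h.finite.measurableSet)
  exact (h.differentiableAt s hs).continuousAt.continuousWithinAt

lemma norm_const (h : LiftedPath c ρ e γ φ E) {s : ℝ} (hs : s ∈ Icc γ.lo γ.hi)
    (hi : γ.toFun s = OnePoint.infty) :
    ∑ i, e i = 0 ∧ c = Complex.exp (φ s * Complex.I) := by
  have h1 := h.eval_eq s hs
  rw [hi] at h1
  exact evalP1_factored_infty (Complex.exp_ne_zero _) h1

/-- No position of `a` is excluded. If the path passes through `a`, the angular bound applies;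
elsewhere the bound on the speed is enough. -/
lemma intervalIntegrable_im_logDeriv (h : LiftedPath c ρ e γ φ E) (a : ℂ) :
    IntervalIntegrable (fun s => (deriv (fun s' => finitePart (γ.toFun s')) s /
      (finitePart (γ.toFun s) - a)).im) volume γ.lo γ.hi := by
  set z : ℝ → ℂ := fun s => finitePart (γ.toFun s) with hz
  refine intervalIntegrable_of_locally_le_deriv γ.lo_lt_hi h.ae_eq ?_ fun s₀ hs₀ => ?_
  · exact (Complex.measurable_im.comp_aemeasurable
      ((measurable_deriv z).aemeasurable.div
        (h.aestronglyMeasurable_finitePart.aemeasurable.sub_const a))).aestronglyMeasurable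
  have hcont := γ.continuousOn s₀ hs₀
  by_cases hinf : γ.toFun s₀ = OnePoint.infty
  · obtain ⟨hsum, hcs⟩ := h.norm_const hs₀ hinf
    have htend : Tendsto γ.toFun (𝓝[Icc γ.lo γ.hi] s₀) (𝓝 OnePoint.infty) := by
      rw [← hinf]; exact hcont
    set w : ℝ → ℂ := fun s => (z s)⁻¹ with hw
    have hw0 : w s₀ = 0 := by simp [hw, hz, hinf, finitePart]
    have hwc : ContinuousWithinAt w (Icc γ.lo γ.hi) s₀ := by
      rw [ContinuousWithinAt, hw0]
      exact tendsto_inv_finitePart_of_infty htend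
    have hlarge := eventually_infty_or_one_lt htend
    have hz0 : ∀ᶠ s in 𝓝[Icc γ.lo γ.hi] s₀, γ.toFun s ≠ OnePoint.infty → z s ≠ 0 :=
      hlarge.mono fun s hs hne => norm_pos_iff.1 (one_pos.trans (hs.resolve_left hne))
    obtain ⟨W, hWm, hW⟩ := exists_monotoneOn_bound_deriv γ.lo_lt_hi hs₀ h.continuousOn
      h.strictMonoOn (fun s hs => (h.hasDerivAt_arg hs).differentiableAt) hwc
      (hz0.mono fun s h0 hs _ => (h.differentiableAt s hs).inv (h0 (h.ne_infty s hs)))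
      (F := fun w => c * ∏ i, (1 - ρ i * w) ^ e i)
      (by rw [hw0]; exact analyticAt_prod_one_sub_mul_zpow) (by
        filter_upwards [hz0, self_mem_nhdsWithin] with s h0 hs
        by_cases hi : γ.toFun s = OnePoint.infty
        · have : w s = 0 := by simp [hw, hz, hi, finitePart]
          rw [this, ← (h.norm_const hs hi).2]
          simp
        · rw [hw, prod_one_sub_mul_inv_zpow hsum (h0 hi), h.prodZpow_eq hs hi])
    have hden : ∀ᶠ s in 𝓝[Icc γ.lo γ.hi] s₀, 1 / 2 < ‖1 - a * w s‖ := by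
      have hc : ContinuousWithinAt (fun s => ‖1 - a * w s‖) (Icc γ.lo γ.hi) s₀ :=
        (continuousWithinAt_const.sub (continuousWithinAt_const.mul hwc)).norm
      refine (hc.tendsto.eventually_const_lt ?_)
      rw [hw0]
      norm_num
    refine ⟨W, hWm, 1 + 2 * ‖a‖, ?_⟩
    filter_upwards [hW, hz0, hden] with s hWs h0 hds hs hne
    obtain ⟨b1, b2⟩ := hWs hs hne
    have hzs : z s ≠ 0 := h0 (h.ne_infty s hs)
    have hws : w s ≠ 0 := inv_ne_zero hzs
    have hd1 : 1 - a * w s ≠ 0 := norm_pos_iff.1 (by linarith)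
    have hdw : deriv w s = -deriv z s / z s ^ 2 :=
      ((h.differentiableAt s hs).hasDerivAt.inv hzs).deriv
    -- With `w = 1/z`, `dz/(z - a) = -dw/w - a dw/(1 - aw)`: the angular form at `w = 0` plus a
    -- regular term.
    have hsplit : deriv z s / (z s - a) =
        -(deriv w s / (w s - w s₀)) - a * (deriv w s / (1 - a * w s)) := by
      have hza : z s - a ≠ 0 := by
        have : z s - a = z s * (1 - a * w s) := by
          rw [hw]; field_simp
        rw [this]
        exact mul_ne_zero hzs hd1
      have h3 : 1 - a * w s = (z s - a) / z s := by rw [hw]; field_simp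
      rw [hw0, sub_zero, h3, hdw]
      simp only [hw]
      field_simp
      ring
    rw [hsplit, Complex.sub_im, Complex.neg_im]
    have b3 : ‖a * (deriv w s / (1 - a * w s))‖ ≤ ‖a‖ * (2 * deriv W s) := by
      rw [norm_mul, norm_div]
      refine mul_le_mul_of_nonneg_left ?_ (norm_nonneg a)
      rw [div_le_iff₀ (by linarith)]
      nlinarith [norm_nonneg (deriv w s)]
    have b4 := (Complex.abs_im_le_norm (a * (deriv w s / (1 - a * w s)))).trans b3
    calc _ ≤ |-(deriv w s / (w s - w s₀)).im| + |(a * (deriv w s / (1 - a * w s))).im| := abs_sub _ _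
      _ ≤ _ := by
        rw [abs_neg]
        linarith
  · have hzc : ContinuousWithinAt z (Icc γ.lo γ.hi) s₀ :=
      tendsto_finitePart_of_ne_infty hcont hinf
    have hninf : ∀ᶠ s in 𝓝[Icc γ.lo γ.hi] s₀, γ.toFun s ≠ OnePoint.infty :=
      hcont.eventually_ne hinf
    obtain ⟨W, hWm, hW⟩ := exists_monotoneOn_bound_deriv γ.lo_lt_hi hs₀ h.continuousOn
      h.strictMonoOn (fun s hs => (h.hasDerivAt_arg hs).differentiableAt) hzc
      (.of_forall fun s hs _ => h.differentiableAt s hs)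
      (F := prodZpow c ρ e) (analyticAt_prodZpow (h.ne_root hs₀ hinf)) (by
        filter_upwards [hninf, self_mem_nhdsWithin] with s hi hs
        exact h.prodZpow_eq hs hi)
    by_cases ha : z s₀ = a
    · refine ⟨W, hWm, 1, ?_⟩
      filter_upwards [hW] with s hWs hs hne
      rw [one_mul, ← ha]
      exact (hWs hs hne).2
    · refine ⟨W, hWm, ‖z s₀ - a‖⁻¹ + 1, ?_⟩
      have hc : ContinuousWithinAt (fun s => ‖z s - a‖⁻¹) (Icc γ.lo γ.hi) s₀ :=
        ((hzc.sub continuousWithinAt_const).norm).inv₀ (norm_ne_zero_iff.2 (sub_ne_zero.2 ha))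
      have hev := hc.tendsto.eventually_lt_const (lt_add_one _)
      filter_upwards [hW, hev] with s hWs hes hs hne
      refine (Complex.abs_im_le_norm _).trans ?_
      rw [norm_div, div_eq_mul_inv, mul_comm]
      exact mul_le_mul hes.le (hWs hs hne).1 (norm_nonneg _) (by positivity)

end LiftedPath

/-! ### The primitive of `log|g| d arg f` along a path -/

lemma continuous_dilogTerm {a b : ℂ} (hab : a ≠ b) : Continuous (dilogTerm a b) := by
  have hba : b - a ≠ 0 := sub_ne_zero.2 hab.symm
  refine continuous_blochWigner.comp (OnePoint.continuous_map (by fun_prop) ?_)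
  rw [coclosedCompact_eq_cocompact]
  let f : ℂ ≃ₜ ℂ := (Homeomorph.subRight a).trans (Homeomorph.mulRight₀ _ (inv_ne_zero hba))
  have hf : (fun t => (t - a) / (b - a)) = f := funext fun t => div_eq_mul_inv _ _
  rw [hf]
  exact f.isClosedEmbedding.tendsto_cocompact

lemma hasDerivAt_dilogTerm {a b : ℂ} (hab : a ≠ b) {z : ℝ → ℂ} {z' : ℂ} {s : ℝ}
    (h : HasDerivAt z z' s) (ha : z s ≠ a) (hb : z s ≠ b) :
    HasDerivAt (fun s => dilogTerm a b (z s : OnePoint ℂ))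
      ((Real.log ‖z s - a‖ - Real.log ‖b - a‖) * (z' / (z s - b)).im -
        (Real.log ‖z s - b‖ - Real.log ‖b - a‖) * (z' / (z s - a)).im) s := by
  have hba : b - a ≠ 0 := sub_ne_zero.2 hab.symm
  have hza : z s - a ≠ 0 := sub_ne_zero.2 ha
  have hzb : z s - b ≠ 0 := sub_ne_zero.2 hb
  have h1 : 1 - (z s - a) / (b - a) = -(z s - b) / (b - a) := by field_simp; ring
  have h2 := hasDerivAt_blochWigner (z := fun s => (z s - a) / (b - a))
    ((h.sub_const a).div_const (b - a)) (div_ne_zero hza hba)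
    (by rw [← sub_ne_zero, ← neg_ne_zero, neg_sub, h1]; exact div_ne_zero (neg_ne_zero.2 hzb) hba)
  refine h2.congr_deriv ?_
  rw [h1, norm_div, norm_div, norm_neg, Real.log_div (norm_ne_zero_iff.2 hza)
    (norm_ne_zero_iff.2 hba), Real.log_div (norm_ne_zero_iff.2 hzb) (norm_ne_zero_iff.2 hba)]
  have e1 : -(z' / (b - a)) / (-(z s - b) / (b - a)) = z' / (z s - b) := by field_simp
  have e2 : z' / (b - a) / ((z s - a) / (b - a)) = z' / (z s - a) := by field_simp
  rw [e1, e2]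

lemma countable_exp_mul_I_eq (x : ℂ) : {u : ℝ | Complex.exp (u * Complex.I) = x}.Countable := by
  by_cases hne : ∃ u : ℝ, Complex.exp (u * Complex.I) = x
  · obtain ⟨u₀, hu₀⟩ := hne
    refine (countable_range fun n : ℤ => u₀ + n * (2 * Real.pi)).mono fun u hu => ?_
    rw [mem_ofPred_eq, ← hu₀, Complex.exp_eq_exp_iff_exists_int] at hu
    obtain ⟨n, hn⟩ := hu
    have := congrArg Complex.im hn
    exact ⟨n, by simpa using this.symm⟩
  · push Not at hne
    exact (countable_empty (α := ℝ)).mono fun u hu => hne u hu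

/-- The algebraic identity behind the differential of the primitive. -/
lemma sum_dilog_deriv_identity {p q : ℕ} (same : Fin p → Fin q → Prop)
    [∀ r s, Decidable (same r s)] (l : Fin p → ℝ) (m : Fin q → ℝ) (a A : Fin p → ℝ)
    (b B : Fin q → ℝ) (d : Fin p → Fin q → ℝ) {x y : ℝ} (hla : x + ∑ r, l r * a r = 0)
    (hsame : ∀ r s, same r s → a r = b s ∧ A r = B s) :
    ∑ r, ∑ s, (if same r s then 0 else
        l r * m s * (-((a r - d r s) * B s - (b s - d r s) * A r))) =
      (y + ∑ s, m s * b s) * (∑ r, l r * A r) -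
        ∑ r, l r * (y + ∑ s, if same r s then 0 else m s * d r s) * A r +
        ∑ s, m s * (x + ∑ r, if same r s then 0 else l r * d r s) * B s := by
  -- The first two terms are kept even for coinciding roots, where they cancel, so they sum over all
  -- pairs to full products.
  have h1 (r : Fin p) (s : Fin q) : (if same r s then 0 else
      l r * m s * (-((a r - d r s) * B s - (b s - d r s) * A r))) =
      l r * A r * (m s * b s) - l r * a r * (m s * B s) -
        l r * A r * (if same r s then 0 else m s * d r s) +
        m s * B s * (if same r s then 0 else l r * d r s) := by
    split_ifs with h
    · rw [(hsame r s h).1, (hsame r s h).2]; ring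
    · ring
  have hx : x = -∑ r, l r * a r := by linarith
  simp only [h1, Finset.sum_add_distrib, Finset.sum_sub_distrib]
  rw [hx, Finset.sum_comm (f := fun r s => m s * B s * (if same r s then 0 else l r * d r s))]
  simp only [← Finset.mul_sum, ← Finset.sum_mul, mul_add, add_mul, Finset.sum_add_distrib]
  have e1 (r : Fin p) : l r * (∑ s, if same r s then 0 else m s * d r s) * A r =
    l r * A r * ∑ s, if same r s then 0 else m s * d r s := by ring
  have e2 (s : Fin q) : m s * (∑ r, if same r s then 0 else l r * d r s) * B s =
    m s * B s * ∑ r, if same r s then 0 else l r * d r s := by ring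
  have e3 (r : Fin p) : l r * y * A r = y * (l r * A r) := by ring
  have e4 (s : Fin q) : m s * (-∑ r, l r * a r) * B s = -(∑ r, l r * a r) * (m s * B s) := by ring
  simp only [e1, e2, e3, e4, ← Finset.mul_sum]
  ring

namespace LiftedPath

open Classical in
-- The function `-Σ l_r m_s D` is continuous along the whole path, including at `β_s` and infinity,
-- and its derivative is integrable. The fundamental theorem of calculus therefore allows a
-- countable exceptional set.
lemma integral_log_norm_mul_deriv {p q : ℕ} {c₁ c₂ : ℂ} {α : Fin p → ℂ} {l : Fin p → ℤ}
    {β : Fin q → ℂ} {m : Fin q → ℤ} {γ : SpherePath} {φ : ℝ → ℝ} {E : Set ℝ}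
    (h : LiftedPath c₁ α l γ φ E) (hc₁ : c₁ ≠ 0) (hc₂ : c₂ ≠ 0)
    (hint : IntervalIntegrable
      (fun s => Real.log ‖prodZpow c₂ β m (finitePart (γ.toFun s))‖ * deriv φ s)
      volume γ.lo γ.hi) :
    (∑ r, ∑ s, if α r = β s then (0 : ℝ) else (l r : ℝ) * (m s : ℝ) *
        (dilogTerm (α r) (β s) γ.initial - dilogTerm (α r) (β s) γ.terminal)) +
      (∑ r, (l r : ℝ) * Real.log ‖tildeEval c₂ β m (α r)‖ * wind γ (α r)) -
      (∑ s, (m s : ℝ) * Real.log ‖tildeEval c₁ α l (β s)‖ * wind γ (β s)) =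
    ∫ s in γ.lo..γ.hi, Real.log ‖prodZpow c₂ β m (finitePart (γ.toFun s))‖ * deriv φ s := by
  set z : ℝ → ℂ := fun s => finitePart (γ.toFun s) with hz
  set ω : ℂ → ℝ → ℝ := fun a s => (deriv z s / (z s - a)).im with hω
  have hωi (a : ℂ) : IntervalIntegrable (ω a) volume γ.lo γ.hi := h.intervalIntegrable_im_logDeriv a
  have hwind (a : ℂ) : wind γ a = ∫ s in γ.lo..γ.hi, ω a s := rfl
  set L : ℝ → ℝ := fun s => Real.log ‖prodZpow c₂ β m (z s)‖ * deriv φ s with hL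
  set Φ : ℝ → ℝ := fun u => ∑ r, ∑ s, if α r = β s then (0 : ℝ) else (l r : ℝ) * (m s : ℝ) *
    (-dilogTerm (α r) (β s) (γ.toFun u)) with hΦ
  set I₁ : ℝ → ℝ := fun u => ∑ r, (l r : ℝ) * Real.log ‖tildeEval c₂ β m (α r)‖ * ω (α r) u
    with hI₁
  set I₂ : ℝ → ℝ := fun u => ∑ s, (m s : ℝ) * Real.log ‖tildeEval c₁ α l (β s)‖ * ω (β s) u
    with hI₂
  have hI₁i : IntervalIntegrable I₁ volume γ.lo γ.hi := by
    have := IntervalIntegrable.sum Finset.univ fun r _ => (hωi (α r)).const_mul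
      ((l r : ℝ) * Real.log ‖tildeEval c₂ β m (α r)‖)
    refine this.congr fun u _ => ?_
    simp [hI₁]
  have hI₂i : IntervalIntegrable I₂ volume γ.lo γ.hi := by
    have := IntervalIntegrable.sum Finset.univ fun s _ => (hωi (β s)).const_mul
      ((m s : ℝ) * Real.log ‖tildeEval c₁ α l (β s)‖)
    refine this.congr fun u _ => ?_
    simp [hI₂]
  -- A point `β_s` is met at only countably many times: `φ` is injective, and at these times
  -- `e^{iφ}` takes the single value `f(β_s)`.
  set T : Set ℝ := E ∪ ⋃ s, {u ∈ Icc γ.lo γ.hi | γ.toFun u = (β s : OnePoint ℂ)} with hT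
  have hTc : T.Countable := by
    refine h.finite.countable.union (countable_iUnion fun s => ?_)
    refine countable_of_injective_of_countable_image (f := φ)
      (h.strictMonoOn.injOn.mono fun u hu => hu.1) ?_
    refine (countable_exp_mul_I_eq (finitePart (evalP1 (factored c₁ α l) (β s)))).mono ?_
    rintro _ ⟨u, ⟨hu, hub⟩, rfl⟩
    have := h.eval_eq u hu
    rw [hub] at this
    rw [mem_ofPred_eq, this]
    rfl
  have hcont : ContinuousOn Φ (uIcc γ.lo γ.hi) := by
    rw [uIcc_of_le γ.lo_lt_hi.le]
    refine continuousOn_finsetSum _ fun r _ => continuousOn_finsetSum _ fun s _ => ?_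
    split_ifs with hrs
    · exact continuousOn_const
    · exact continuousOn_const.mul
        ((continuous_dilogTerm hrs).comp_continuousOn γ.continuousOn).neg
  have hder : ∀ u ∈ Ioo (min γ.lo γ.hi) (max γ.lo γ.hi) \ T,
      HasDerivAt Φ (L u - I₁ u + I₂ u) u := by
    rw [min_eq_left γ.lo_lt_hi.le, max_eq_right γ.lo_lt_hi.le]
    rintro u ⟨hu, huT⟩
    have huE : u ∈ Ioo γ.lo γ.hi \ E := ⟨hu, fun hE => huT (.inl hE)⟩
    have huI := Ioo_subset_Icc_self hu
    have hninf := h.ne_infty u huE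
    have hdz := (h.differentiableAt u huE).hasDerivAt
    have hα := h.ne_root huI hninf
    have hβ (s : Fin q) : z u ≠ β s := fun hs => huT (.inr (mem_iUnion.2 ⟨s, huI, by
      rw [← hs, hz, coe_finitePart hninf]⟩))
    have h1 (r : Fin p) (s : Fin q) : HasDerivAt (fun u => if α r = β s then (0 : ℝ) else
        (l r : ℝ) * (m s : ℝ) * (-dilogTerm (α r) (β s) (γ.toFun u)))
        (if α r = β s then (0 : ℝ) else (l r : ℝ) * (m s : ℝ) *
          (-((Real.log ‖z u - α r‖ - Real.log ‖β s - α r‖) * ω (β s) u -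
            (Real.log ‖z u - β s‖ - Real.log ‖β s - α r‖) * ω (α r) u))) u := by
      split_ifs with hrs
      · exact hasDerivAt_const _ _
      · refine HasDerivAt.const_mul _ (HasDerivAt.neg ?_)
        refine (hasDerivAt_dilogTerm hrs hdz (hα r) (hβ s)).congr_of_eventuallyEq ?_
        filter_upwards [h.eventually_mem huE] with x hx
        rw [coe_finitePart (h.ne_infty x hx)]
    refine (HasDerivAt.fun_sum fun r _ => HasDerivAt.fun_sum fun s _ => h1 r s).congr_deriv ?_
    rw [sum_dilog_deriv_identity (fun r s => α r = β s) (fun r => (l r : ℝ)) (fun s => (m s : ℝ))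
      (fun r => Real.log ‖z u - α r‖) (fun r => ω (α r) u) (fun s => Real.log ‖z u - β s‖)
      (fun s => ω (β s) u) (fun r s => Real.log ‖β s - α r‖) (x := Real.log ‖c₁‖)
      (y := Real.log ‖c₂‖) ?_ ?_]
    · simp only [hL, hI₁, hI₂]
      rw [log_norm_prodZpow hc₂ hβ, (h.hasDerivAt_arg huE).deriv]
      congr 1
      · congr 1
        refine Finset.sum_congr rfl fun r _ => ?_
        rw [log_norm_tildeEval hc₂]
        congr 3
        refine Finset.sum_congr rfl fun s _ => ?_
        rw [norm_sub_rev]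
        simp only [eq_comm]
      · refine Finset.sum_congr rfl fun s _ => ?_
        rw [log_norm_tildeEval hc₁]
    · rw [← log_norm_prodZpow hc₁ hα, h.prodZpow_eq huI hninf, Complex.norm_exp_ofReal_mul_I,
        Real.log_one]
    · rintro r s hrs
      simp only [hrs, and_self]
  have hFTC := integral_eq_of_hasDerivAt_off_countable Φ (fun u => L u - I₁ u + I₂ u) hTc hcont
    hder ((hint.sub hI₁i).add hI₂i)
  have hI₁e : ∫ u in γ.lo..γ.hi, I₁ u =
      ∑ r, (l r : ℝ) * Real.log ‖tildeEval c₂ β m (α r)‖ * wind γ (α r) := by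
    rw [intervalIntegral.integral_finsetSum fun r _ => (hωi (α r)).const_mul _]
    exact Finset.sum_congr rfl fun r _ => intervalIntegral.integral_const_mul _ _
  have hI₂e : ∫ u in γ.lo..γ.hi, I₂ u =
      ∑ s, (m s : ℝ) * Real.log ‖tildeEval c₁ α l (β s)‖ * wind γ (β s) := by
    rw [intervalIntegral.integral_finsetSum fun s _ => (hωi (β s)).const_mul _]
    exact Finset.sum_congr rfl fun s _ => intervalIntegral.integral_const_mul _ _
  rw [intervalIntegral.integral_add (hint.sub hI₁i) hI₂i,
    intervalIntegral.integral_sub hint hI₁i, hI₁e, hI₂e] at hFTC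
  have hΦd : Φ γ.hi - Φ γ.lo = ∑ r, ∑ s, if α r = β s then (0 : ℝ) else (l r : ℝ) * (m s : ℝ) *
      (dilogTerm (α r) (β s) γ.initial - dilogTerm (α r) (β s) γ.terminal) := by
    simp only [hΦ, ← Finset.sum_sub_distrib]
    refine Finset.sum_congr rfl fun r _ => Finset.sum_congr rfl fun s _ => ?_
    split_ifs
    · simp
    · rw [SpherePath.initial, SpherePath.terminal]; ring
  rw [← hΦd]
  linarith

end LiftedPath

/-! ### Jensen's formula in the second variable -/

/-- The polynomial `P(x, ·)`. -/
noncomputable def specialize (P : Polynomial (Polynomial ℂ)) (x : ℂ) : ℂ[X] :=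
  P.map (Polynomial.evalRingHom x)

lemma eval_specialize (P : Polynomial (Polynomial ℂ)) (x y : ℂ) :
    (specialize P x).eval y = P.evalEval x y := by
  rw [specialize, Polynomial.eval_map, Polynomial.eval₂_evalRingHom]

lemma eval_derivative_specialize (P : Polynomial (Polynomial ℂ)) (x y : ℂ) :
    (Polynomial.derivative (specialize P x)).eval y = (Polynomial.derivative P).evalEval x y := by
  rw [← eval_specialize, specialize, specialize, Polynomial.derivative_map]

/-- `Σ log⁺|y|`, where `y` runs over the roots of `P(x, ·)`. -/
noncomputable def sumPosLogRoots (P : Polynomial (Polynomial ℂ)) (x : ℂ) : ℝ :=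
  ((specialize P x).roots.map fun y => Real.posLog ‖y‖).sum

lemma sumPosLogRoots_nonneg (P : Polynomial (Polynomial ℂ)) (x : ℂ) : 0 ≤ sumPosLogRoots P x := by
  refine Multiset.sum_nonneg fun a ha => ?_
  obtain ⟨y, _, rfl⟩ := Multiset.mem_map.1 ha
  exact Real.posLog_nonneg

lemma logMahlerMeasure_specialize {P : Polynomial (Polynomial ℂ)} {x : ℂ}
    (hx : P.leadingCoeff.eval x ≠ 0) : (specialize P x).logMahlerMeasure =
      Real.log ‖P.leadingCoeff.eval x‖ + sumPosLogRoots P x := by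
  rw [Polynomial.logMahlerMeasure_eq_log_leadingCoeff_add_sum_log_roots, sumPosLogRoots]
  congr 3
  exact Polynomial.leadingCoeff_map_of_leadingCoeff_ne_zero _ hx

lemma continuous_evalEval (P : Polynomial (Polynomial ℂ)) :
    Continuous fun p : ℂ × ℂ => P.evalEval p.1 p.2 := by
  induction P using Polynomial.induction_on' with
  | add p q hp hq =>
    simp only [Polynomial.evalEval_add]
    exact hp.add hq
  | monomial n a =>
    simp only [Polynomial.evalEval, Polynomial.eval_monomial, Polynomial.eval_mul,
      Polynomial.eval_pow, Polynomial.eval_C]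
    exact (a.continuous.comp continuous_fst).mul (continuous_snd.pow n)

lemma ae_exp_mul_I_notMem {X : Set ℂ} (hX : X.Finite) :
    ∀ᵐ θ : ℝ, Complex.exp (θ * Complex.I) ∉ X := by
  have : {θ : ℝ | Complex.exp (θ * Complex.I) ∈ X}.Countable := by
    have h : {θ : ℝ | Complex.exp (θ * Complex.I) ∈ X} =
        ⋃ x ∈ X, {θ : ℝ | Complex.exp (θ * Complex.I) = x} := by ext; simp
    rw [h]
    exact hX.countable.biUnion fun x _ => countable_exp_mul_I_eq x
  simpa [ae_iff] using this.measure_zero volume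

lemma setIntegral_Icc_eq (f : ℂ → ℝ) :
    ∫ θ in Icc (0 : ℝ) (2 * Real.pi), f (Complex.exp (θ * Complex.I)) =
      2 * Real.pi * Real.circleAverage f 0 1 := by
  rw [Real.circleAverage_def, smul_eq_mul, mul_inv_cancel_left₀ Real.two_pi_pos.ne',
    integral_Icc_eq_integral_Ioc, ← intervalIntegral.integral_of_le Real.two_pi_pos.le]
  simp [circleMap]

lemma integrableOn_log_norm_eval_exp (p : ℂ[X]) :
    IntegrableOn (fun θ : ℝ => Real.log ‖p.eval (Complex.exp (θ * Complex.I))‖)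
      (Icc 0 (2 * Real.pi)) := by
  have := p.intervalIntegrable_mahlerMeasure
  rw [intervalIntegrable_iff_integrableOn_Icc_of_le Real.two_pi_pos.le] at this
  simpa [circleMap] using this

/-- Jensen's formula on each fibre, then Fubini. Joint integrability is itself a consequence of
Jensen, since `log|P|` is bounded above and its fibre integrals are bounded below by those of
`log|λ|`. -/
theorem logMahler₂_eq_integral {P : Polynomial (Polynomial ℂ)} (hP : P ≠ 0) :
    IntegrableOn (fun θ : ℝ => sumPosLogRoots P (Complex.exp (θ * Complex.I)))
      (Icc 0 (2 * Real.pi)) ∧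
    2 * Real.pi * logMahler₂ P = 2 * Real.pi * P.leadingCoeff.logMahlerMeasure +
      ∫ θ in Icc (0 : ℝ) (2 * Real.pi), sumPosLogRoots P (Complex.exp (θ * Complex.I)) := by
  set I := Icc (0 : ℝ) (2 * Real.pi) with hI
  set ν : Measure ℝ := volume.restrict I with hν
  set e : ℝ → ℂ := fun θ => Complex.exp (θ * Complex.I) with he
  set f : ℝ × ℝ → ℝ := fun p => Real.log ‖P.evalEval (e p.1) (e p.2)‖ with hf
  have hec : Continuous e := by fun_prop
  have hPc : Continuous fun p : ℝ × ℝ => P.evalEval (e p.1) (e p.2) :=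
    (continuous_evalEval P).comp
      ((hec.comp continuous_fst).prodMk (hec.comp continuous_snd))
  have hfm : Measurable f := Real.measurable_log.comp hPc.norm.measurable
  have hfm' : AEStronglyMeasurable f (ν.prod ν) := hfm.aestronglyMeasurable
  have hinner (θ : ℝ) : Integrable (fun φ => f (θ, φ)) ν := by
    have := integrableOn_log_norm_eval_exp (specialize P (e θ))
    simp only [eval_specialize] at this
    exact this
  have hinner_eq (θ : ℝ) : ∫ φ, f (θ, φ) ∂ν =
      2 * Real.pi * (specialize P (e θ)).logMahlerMeasure := by
    have := setIntegral_Icc_eq fun y => Real.log ‖(specialize P (e θ)).eval y‖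
    rw [← Polynomial.logMahlerMeasure_def] at this
    simp only [eval_specialize] at this
    exact this
  have hlead : ∀ᵐ θ ∂ν, P.leadingCoeff.eval (e θ) ≠ 0 := by
    refine ae_restrict_of_ae ?_
    have hfin : {x | P.leadingCoeff.IsRoot x}.Finite :=
      Polynomial.finite_setOfPred_isRoot (Polynomial.leadingCoeff_ne_zero.2 hP)
    exact (ae_exp_mul_I_notMem hfin).mono fun θ hθ => hθ
  have hdecomp : ∀ᵐ θ ∂ν, ∫ φ, f (θ, φ) ∂ν = 2 * Real.pi *
      (Real.log ‖P.leadingCoeff.eval (e θ)‖ + sumPosLogRoots P (e θ)) :=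
    hlead.mono fun θ hθ => by rw [hinner_eq, logMahlerMeasure_specialize hθ]
  have hl : Integrable (fun θ => Real.log ‖P.leadingCoeff.eval (e θ)‖) ν :=
    integrableOn_log_norm_eval_exp _
  obtain ⟨C, hC⟩ : ∃ C : ℝ, ∀ p ∈ I ×ˢ I, ‖P.evalEval (e p.1) (e p.2)‖ ≤ C :=
    (isCompact_Icc.prod isCompact_Icc).exists_bound_of_continuousOn hPc.continuousOn
  set K := Real.log (max C 1) with hK
  have hK0 : 0 ≤ K := Real.log_nonneg (le_max_right _ _)
  have hfK : ∀ p ∈ I ×ˢ I, f p ≤ K := fun p hp => by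
    rcases (norm_nonneg (P.evalEval (e p.1) (e p.2))).eq_or_lt with h0 | h0
    · simp only [hf, ← h0, Real.log_zero, hK0]
    · exact Real.log_le_log h0 ((hC p hp).trans (le_max_left _ _))
  -- An upper bound `K ≥ 0` controls the absolute value by an affine function of `f`, whose fibre
  -- integral is known.
  have hfabs : ∀ p ∈ I ×ˢ I, ‖f p‖ ≤ 2 * K - f p := fun p hp => by
    rw [Real.norm_eq_abs, abs_le]
    constructor <;> linarith [hfK p hp]
  have hνI : ν.real univ = 2 * Real.pi := by
    rw [hν, measureReal_restrict_apply_univ, hI, Real.volume_real_Icc_of_le Real.two_pi_pos.le,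
      sub_zero]
  have hfi : Integrable f (ν.prod ν) := by
    rw [integrable_prod_iff hfm']
    refine ⟨.of_forall hinner, ?_⟩
    refine Integrable.mono' (g := fun θ => 2 * Real.pi * (2 * K -
      Real.log ‖P.leadingCoeff.eval (e θ)‖)) (((integrable_const _).sub hl).const_mul _)
      hfm'.norm.integral_prod_right' ?_
    filter_upwards [hdecomp, ae_restrict_mem measurableSet_Icc] with θ hθ hmem
    rw [Real.norm_of_nonneg (integral_nonneg fun _ => norm_nonneg _)]
    have h1 : ∫ φ, ‖f (θ, φ)‖ ∂ν ≤ ∫ φ, (2 * K - f (θ, φ)) ∂ν := by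
      refine integral_mono_ae (hinner θ).norm ((integrable_const _).sub (hinner θ)) ?_
      filter_upwards [ae_restrict_mem measurableSet_Icc] with φ hφ
      exact hfabs (θ, φ) ⟨hmem, hφ⟩
    rw [integral_sub (integrable_const _) (hinner θ), integral_const, hνI, hθ, smul_eq_mul] at h1
    nlinarith [mul_nonneg Real.two_pi_pos.le (sumPosLogRoots_nonneg P (e θ))]
  have hM := hfi.integral_prod_left.congr hdecomp
  have hR : Integrable (fun θ => sumPosLogRoots P (e θ)) ν := by
    refine ((hM.const_mul (2 * Real.pi)⁻¹).sub hl).congr (.of_forall fun θ => ?_)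
    simp only [Pi.sub_apply]
    rw [inv_mul_cancel_left₀ Real.two_pi_pos.ne']
    ring
  refine ⟨hR, ?_⟩
  have h1 : logMahler₂ P = (2 * Real.pi)⁻¹ ^ 2 * ∫ p, f p ∂(ν.prod ν) := by
    rw [logMahler₂, hν, Measure.prod_restrict]
    rfl
  have h2 : ∫ θ, Real.log ‖P.leadingCoeff.eval (e θ)‖ ∂ν =
      2 * Real.pi * P.leadingCoeff.logMahlerMeasure :=
    setIntegral_Icc_eq fun y => Real.log ‖P.leadingCoeff.eval y‖
  rw [h1, integral_prod f hfi, integral_congr_ae hdecomp, integral_const_mul,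
    integral_add hl hR, h2]
  have : Real.pi ≠ 0 := Real.pi_ne_zero
  field_simp
  rfl

/-! ### Generic fibres of an irreducible curve -/

/-- By Gauss's lemma `P` stays irreducible over `ℂ(x)`, hence is separable in characteristic zero.
The resultant of `P` and `∂P/∂y` is then a nonzero polynomial in `x`, lying in the ideal they
generate. -/
lemma exists_ne_zero_forall_derivative_ne_zero {P : Polynomial (Polynomial ℂ)}
    (hP : Irreducible P) : ∃ r : ℂ[X], r ≠ 0 ∧ ∀ x y : ℂ, r.eval x ≠ 0 → P.evalEval x y = 0 →
      (Polynomial.derivative P).evalEval x y ≠ 0 := by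
  -- If `P` does not involve `y`, then `P` itself serves as `r`, since there are no points over
  -- `r(x) ≠ 0`.
  by_cases hdeg : P.natDegree = 0
  · rw [Polynomial.natDegree_eq_zero] at hdeg
    obtain ⟨a, rfl⟩ := hdeg
    refine ⟨a, fun h => hP.ne_zero (by rw [h, map_zero]), fun x y hx h => absurd ?_ hx⟩
    rwa [Polynomial.evalEval_C] at h
  have hirr := ((hP.isPrimitive hdeg).irreducible_iff_irreducible_map_fraction_map
    (K := RatFunc ℂ)).1 hP
  have hsep := hirr.separable
  have hcop : IsCoprime (P.map (algebraMap ℂ[X] (RatFunc ℂ)))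
      ((Polynomial.derivative P).map (algebraMap ℂ[X] (RatFunc ℂ))) := by
    rw [← Polynomial.derivative_map]; exact hsep
  have hinj := RatFunc.algebraMap_injective ℂ
  have hres : P.resultant (Polynomial.derivative P) ≠ 0 := by
    intro h
    refine Polynomial.resultant_ne_zero _ _ hcop ?_
    rw [Polynomial.natDegree_map_eq_of_injective hinj, Polynomial.natDegree_map_eq_of_injective hinj,
      Polynomial.resultant_map_map, h, map_zero]
  refine ⟨_, hres, fun x y hx h0 h1 => hx ?_⟩
  obtain ⟨a, b, -, -, hab⟩ := P.exists_mul_add_mul_eq_C_resultant (Polynomial.derivative P)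
    le_rfl le_rfl (Or.inl hdeg)
  have := congrArg (Polynomial.evalEval x y) hab
  rw [Polynomial.evalEval_add, Polynomial.evalEval_mul, Polynomial.evalEval_mul, h0, h1,
    Polynomial.evalEval_C] at this
  simpa using this.symm

lemma nodup_roots_specialize {P : Polynomial (Polynomial ℂ)} {x : ℂ} (h0 : specialize P x ≠ 0)
    (h : ∀ y, P.evalEval x y = 0 → (Polynomial.derivative P).evalEval x y ≠ 0) :
    (specialize P x).roots.Nodup := by
  classical
  rw [Multiset.nodup_iff_count_le_one]
  intro y
  rw [Polynomial.count_roots]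
  by_contra hlt
  obtain ⟨h1, h2⟩ := (Polynomial.one_lt_rootMultiplicity_iff_isRoot h0).1 (not_le.1 hlt)
  rw [Polynomial.IsRoot.def, eval_specialize] at h1
  rw [Polynomial.IsRoot.def, eval_derivative_specialize] at h2
  exact h y h1 h2

/-! ### Folding the paths onto the circle -/

/-- The group of the periods of `θ ↦ e^{iθ}`. -/
noncomputable abbrev periods : AddSubgroup ℝ := AddSubgroup.zmultiples (2 * Real.pi)

lemma exp_mul_I_eq_iff {u v : ℝ} :
    Complex.exp (u * Complex.I) = Complex.exp (v * Complex.I) ↔ u - v ∈ periods := by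
  rw [Complex.exp_eq_exp_iff_exists_int, AddSubgroup.mem_zmultiples_iff]
  refine exists_congr fun n => ⟨fun h => ?_, fun h => ?_⟩
  · have := congrArg Complex.im h
    simp only [Complex.mul_im, Complex.ofReal_re, Complex.I_im, mul_one, Complex.ofReal_im,
      Complex.I_re, mul_zero, add_zero, Complex.add_im] at this
    simp at this
    rw [zsmul_eq_mul]
    linarith
  · have h1 : (u : ℂ) = v + n * (2 * Real.pi) := by
      rw [zsmul_eq_mul] at h
      have : u = v + n * (2 * Real.pi) := by linarith
      rw [this]; push_cast; ring
    rw [h1]; ring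

/-- The translates of `(0, 2π]` tile the line. Working with values in `ENNReal` makes integrability
unnecessary. -/
lemma lintegral_fold_periods {H : ℝ → ENNReal} (hH : AEMeasurable H) :
    ∫⁻ θ in Ioc 0 (2 * Real.pi), ∑' g : periods, H (g + θ) = ∫⁻ u, H u := by
  have hfd := isAddFundamentalDomain_Ioc Real.two_pi_pos 0
  rw [zero_add] at hfd
  rw [hfd.lintegral_eq_tsum'', lintegral_tsum]
  · rfl
  · intro g
    exact (hH.comp_quasiMeasurePreserving
      (measurePreserving_add_left volume (g : ℝ)).quasiMeasurePreserving).restrict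

/-- The function `u ↦ h(γ(φ⁻¹(u)))` on the range of `φ`, extended by zero. -/
noncomputable def pushAlong (γ : SpherePath) (φ : ℝ → ℝ) (h : ℂ → ℝ) : ℝ → ENNReal :=
  (φ '' Icc γ.lo γ.hi).indicator fun u =>
    ENNReal.ofReal (h (finitePart (γ.toFun (Function.invFunOn φ (Icc γ.lo γ.hi) u))))

namespace LiftedPath

variable {k : ℕ} {c : ℂ} {ρ : Fin k → ℂ} {e : Fin k → ℤ} {γ : SpherePath} {φ : ℝ → ℝ} {E : Set ℝ}

lemma invFunOn_apply (h : LiftedPath c ρ e γ φ E) {s : ℝ} (hs : s ∈ Icc γ.lo γ.hi) :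
    Function.invFunOn φ (Icc γ.lo γ.hi) (φ s) = s :=
  h.strictMonoOn.injOn (Function.invFunOn_mem ⟨s, hs, rfl⟩) hs
    (Function.invFunOn_eq ⟨s, hs, rfl⟩)

lemma measurableSet_domain (h : LiftedPath c ρ e γ φ E) :
    MeasurableSet (Ioo γ.lo γ.hi \ E) := measurableSet_Ioo.diff h.finite.measurableSet

lemma image_ae_eq (h : LiftedPath c ρ e γ φ E) :
    φ '' (Ioo γ.lo γ.hi \ E) =ᵐ[volume] φ '' Icc γ.lo γ.hi := by
  have hsub : φ '' (Ioo γ.lo γ.hi \ E) ⊆ φ '' Icc γ.lo γ.hi :=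
    image_mono fun s hs => Ioo_subset_Icc_self hs.1
  refine hsub.eventuallyLE.antisymm (ae_le_set.2 ?_)
  have hfin : (φ '' (E ∪ {γ.lo, γ.hi})).Finite := (h.finite.union (by simp)).image φ
  refine measure_mono_null ?_ (hfin.measure_zero volume)
  rintro _ ⟨⟨s, hs, rfl⟩, hn⟩
  by_contra hs'
  refine hn ⟨s, ⟨⟨lt_of_le_of_ne hs.1 ?_, lt_of_le_of_ne hs.2 ?_⟩, ?_⟩, rfl⟩
  · rintro rfl; exact hs' ⟨_, by simp, rfl⟩
  · rintro rfl; exact hs' ⟨_, by simp, rfl⟩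
  · exact fun hE => hs' ⟨_, .inl hE, rfl⟩

lemma measurableSet_image (h : LiftedPath c ρ e γ φ E) : MeasurableSet (φ '' Icc γ.lo γ.hi) :=
  (isCompact_Icc.image_of_continuousOn h.continuousOn).measurableSet

/-- The inverse of `φ` is monotone, hence measurable, and the path is continuous off finitely many
times. -/
lemma aemeasurable_pushAlong (h : LiftedPath c ρ e γ φ E) {w : ℂ → ℝ} (hw : Measurable w) :
    AEMeasurable (pushAlong γ φ w) := by
  classical
  rw [pushAlong, aemeasurable_indicator_iff h.measurableSet_image]
  have hψ : AEMeasurable (Function.invFunOn φ (Icc γ.lo γ.hi))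
      (volume.restrict (φ '' Icc γ.lo γ.hi)) := by
    refine aemeasurable_restrict_of_monotoneOn h.measurableSet_image ?_
    rintro _ ⟨s, hs, rfl⟩ _ ⟨t, ht, rfl⟩ hst
    rw [h.invFunOn_apply hs, h.invFunOn_apply ht]
    exact (h.strictMonoOn.le_iff_le hs ht).1 hst
  have hz : Measurable ((Ioo γ.lo γ.hi \ E).piecewise (fun s => finitePart (γ.toFun s)) 0) :=
    ContinuousOn.measurable_piecewise
      (fun s hs => (h.differentiableAt s hs).continuousAt.continuousWithinAt)
      continuousOn_const h.measurableSet_domain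
  refine ((hw.comp hz).comp_aemeasurable hψ).ennreal_ofReal.congr ?_
  rw [← Measure.restrict_congr_set h.image_ae_eq]
  have himg : MeasurableSet (φ '' (Ioo γ.lo γ.hi \ E)) :=
    h.measurableSet_domain.image_of_continuousOn_injOn
      (h.continuousOn.mono fun s hs => Ioo_subset_Icc_self hs.1)
      (h.strictMonoOn.injOn.mono fun s hs => Ioo_subset_Icc_self hs.1)
  filter_upwards [ae_restrict_mem himg] with u hu
  obtain ⟨s, hs, rfl⟩ := hu
  simp only [Function.comp_apply, h.invFunOn_apply (Ioo_subset_Icc_self hs.1)]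
  rw [piecewise_eq_of_mem _ _ _ hs]

lemma deriv_nonneg (h : LiftedPath c ρ e γ φ E) {s : ℝ} (hs : s ∈ Ioo γ.lo γ.hi \ E) :
    0 ≤ deriv φ s := by
  rw [← derivWithin_of_mem_nhds (Icc_mem_nhds hs.1.1 hs.1.2)]
  exact h.strictMonoOn.monotoneOn.derivWithin_nonneg

lemma lintegral_pushAlong (h : LiftedPath c ρ e γ φ E) (w : ℂ → ℝ) :
    ∫⁻ u, pushAlong γ φ w u = ∫⁻ s in Ioo γ.lo γ.hi \ E,
      ENNReal.ofReal (w (finitePart (γ.toFun s)) * deriv φ s) := by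
  rw [pushAlong, lintegral_indicator h.measurableSet_image,
    ← Measure.restrict_congr_set h.image_ae_eq,
    lintegral_image_eq_lintegral_deriv_mul_of_monotoneOn h.measurableSet_domain
      (fun s hs => (h.hasDerivAt_arg hs).differentiableAt.hasDerivAt.hasDerivWithinAt)
      (h.strictMonoOn.monotoneOn.mono fun s hs => Ioo_subset_Icc_self hs.1)]
  refine setLIntegral_congr_fun h.measurableSet_domain fun s hs => ?_
  simp only [h.invFunOn_apply (Ioo_subset_Icc_self hs.1)]
  rw [mul_comm, ENNReal.ofReal_mul' (h.deriv_nonneg hs)]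

end LiftedPath

/-! ### Roots of `P(x, ·)` as points on the paths -/

lemma ofReal_sumPosLogRoots {P : Polynomial (Polynomial ℂ)} {x : ℂ}
    (h : (specialize P x).roots.Nodup) : ENNReal.ofReal (sumPosLogRoots P x) =
      ∑' y : {y // y ∈ (specialize P x).roots ∧ 1 ≤ ‖y‖}, ENNReal.ofReal (Real.log ‖(y : ℂ)‖) := by
  classical
  have h1 : sumPosLogRoots P x = ∑ y ∈ (specialize P x).roots.toFinset, Real.posLog ‖y‖ := by
    rw [sumPosLogRoots, Finset.sum, Multiset.toFinset_val, h.dedup]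
  rw [h1, ENNReal.ofReal_sum_of_nonneg fun y _ => Real.posLog_nonneg]
  have h2 : ∑ y ∈ (specialize P x).roots.toFinset, ENNReal.ofReal (Real.posLog ‖y‖) =
      ∑ y ∈ (specialize P x).roots.toFinset.filter (fun y => 1 ≤ ‖y‖),
        ENNReal.ofReal (Real.log ‖y‖) := by
    rw [Finset.sum_filter]
    refine Finset.sum_congr rfl fun y _ => ?_
    split_ifs with hy
    · rw [Real.posLog_eq_log (by rwa [abs_norm])]
    · rw [(Real.posLog_eq_zero_iff _).2 (by rw [abs_norm]; exact (not_le.1 hy).le),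
        ENNReal.ofReal_zero]
  rw [h2, ← Finset.tsum_subtype]
  refine (Equiv.tsum_eq (Equiv.subtypeEquivRight fun y => ?_)
    fun y : {y // y ∈ (specialize P x).roots ∧ 1 ≤ ‖y‖} => ENNReal.ofReal (Real.log ‖(y : ℂ)‖))
  simp

/-- For generic `x = e^{iθ}`, a root `y` with `|y| ≥ 1` corresponds to a path together with a lift
of `θ` in the range of its `φ`. Root to parameter `t` uses nonsingularity; `t` to path and time uses
the covering condition; time to lift uses injectivity of `φ`. -/
lemma exists_finite_forall_sumPosLogRoots_eq {P : Polynomial (Polynomial ℂ)} {p q n : ℕ}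
    {c₁ c₂ : ℂ} {α : Fin p → ℂ} {l : Fin p → ℤ} {β : Fin q → ℂ} {m : Fin q → ℤ}
    (hP : IsParametrization P (factored c₁ α l) (factored c₂ β m)) {γ : Fin n → SpherePath}
    (hγ : ArePathsOver P (factored c₁ α l) (factored c₂ β m) γ)
    {φ : Fin n → ℝ → ℝ} {E : Fin n → Set ℝ} (hL : ∀ j, LiftedPath c₁ α l (γ j) (φ j) (E j)) :
    ∃ X : Set ℂ, X.Finite ∧ ∀ θ : ℝ, Complex.exp (θ * Complex.I) ∉ X →
      ENNReal.ofReal (sumPosLogRoots P (Complex.exp (θ * Complex.I))) =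
        ∑ j, ∑' g : periods,
          pushAlong (γ j) (φ j) (fun t => Real.log ‖prodZpow c₂ β m t‖) (g + θ) := by
  have hP0 : P ≠ 0 := hP.irreducible.ne_zero
  obtain ⟨r, hr0, hr⟩ := exists_ne_zero_forall_derivative_ne_zero hP.irreducible
  obtain ⟨F, hF, hcov⟩ := hγ.covers
  -- Besides the points not covered exactly once, `T` contains `∞` and the `β_s`, where `g` need not
  -- be given by the product formula.
  set T : Set (OnePoint ℂ) := F ∪ {OnePoint.infty} ∪ range (fun s => (β s : OnePoint ℂ)) with hT
  have hTfin : T.Finite := (hF.union (finite_singleton _)).union (finite_range _)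
  refine ⟨{x | P.leadingCoeff.IsRoot x} ∪ {x | r.IsRoot x} ∪
    (fun t => finitePart (evalP1 (factored c₁ α l) t)) '' T,
    ((Polynomial.finite_setOfPred_isRoot (Polynomial.leadingCoeff_ne_zero.2 hP0)).union
      (Polynomial.finite_setOfPred_isRoot hr0)).union (hTfin.image _), fun θ hθ => ?_⟩
  set x := Complex.exp (θ * Complex.I) with hx
  simp only [mem_union, not_or] at hθ
  obtain ⟨⟨hlead, hrx⟩, hxT⟩ := hθ
  have hnT (t : OnePoint ℂ) (ht : evalP1 (factored c₁ α l) t = (x : OnePoint ℂ)) : t ∉ T :=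
    fun h => hxT ⟨t, h, by simp only [ht]; rfl⟩
  have hsing (y : ℂ) (hy : P.evalEval x y = 0) : (Polynomial.derivative P).evalEval x y ≠ 0 :=
    hr x y hrx hy
  have hsp0 : specialize P x ≠ 0 := by
    intro h0
    apply hlead
    have := congrArg (fun Q => Polynomial.coeff Q P.natDegree) h0
    simpa [specialize] using this
  have hgval (t : OnePoint ℂ) (ht : t ∉ T) :
      evalP1 (factored c₂ β m) t = (prodZpow c₂ β m (finitePart t) : OnePoint ℂ) := by
    have hi : t ≠ OnePoint.infty := fun h => ht (.inl (.inr h))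
    have := evalP1_factored_of_ne (c := c₂) (e := m) (ρ := β) (t := finitePart t) fun s hs =>
      ht (.inr ⟨s, by rw [← coe_finitePart hi, hs]⟩)
    rwa [coe_finitePart hi] at this
  rw [ofReal_sumPosLogRoots (nodup_roots_specialize hsp0 hsing)]
  set w : ℂ → ℝ := fun t => Real.log ‖prodZpow c₂ β m t‖ with hw
  set σ : Fin n × periods → ℝ := fun k =>
    Function.invFunOn (φ k.1) (Icc (γ k.1).lo (γ k.1).hi) (k.2 + θ) with hσ
  set S : Set (Fin n × periods) :=
    {k | (k.2 : ℝ) + θ ∈ φ k.1 '' Icc (γ k.1).lo (γ k.1).hi} with hS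
  set τ : Fin n × periods → ℂ := fun k => finitePart ((γ k.1).toFun (σ k)) with hτ
  have hσI (k) (hk : k ∈ S) : σ k ∈ Icc (γ k.1).lo (γ k.1).hi := Function.invFunOn_mem hk
  have hσφ (k) (hk : k ∈ S) : φ k.1 (σ k) = k.2 + θ := Function.invFunOn_eq hk
  have hfx (k) (hk : k ∈ S) :
      evalP1 (factored c₁ α l) ((γ k.1).toFun (σ k)) = (x : OnePoint ℂ) := by
    rw [(hL k.1).eval_eq _ (hσI k hk), hσφ k hk, hx, OnePoint.coe_eq_coe, exp_mul_I_eq_iff,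
      add_sub_cancel_right]
    exact k.2.2
  have hxn : ‖x‖ = 1 := Complex.norm_exp_ofReal_mul_I θ
  have hroot (k) (hk : k ∈ S) : P.evalEval x (prodZpow c₂ β m (τ k)) = 0 ∧
      1 ≤ ‖prodZpow c₂ β m (τ k)‖ := by
    have hg := hgval _ (hnT _ (hfx k hk))
    obtain ⟨x', hx', h⟩ := hγ.mapsTo k.1 (σ k) (hσI k hk)
    rw [hfx k hk, OnePoint.coe_eq_coe] at hx'
    subst hx'
    rcases h with ⟨y, hy, hmem⟩ | ⟨-, hy⟩
    · rw [hg, OnePoint.coe_eq_coe] at hy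
      rw [← hy] at hmem
      exact ⟨hmem.1, hmem.2.2⟩
    · rw [hg] at hy
      exact absurd hy (OnePoint.coe_ne_infty _)
  let Y := {y // y ∈ (specialize P x).roots ∧ 1 ≤ ‖y‖}
  let b : S → Y := fun k => ⟨prodZpow c₂ β m (τ k),
    (Polynomial.mem_roots hsp0).2 (by
      rw [Polynomial.IsRoot.def, eval_specialize]; exact (hroot k k.2).1), (hroot k k.2).2⟩
  have hb : Function.Bijective b := by
    constructor
    · rintro ⟨k, hk⟩ ⟨k', hk'⟩ hkk
      have hy : prodZpow c₂ β m (τ k) = prodZpow c₂ β m (τ k') := congrArg Subtype.val hkk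
      have hns : IsNonsingularPoint P x (prodZpow c₂ β m (τ k)) :=
        ⟨(hroot k hk).1, .inr (hsing _ (hroot k hk).1)⟩
      have ht : (γ k.1).toFun (σ k) = (γ k'.1).toFun (σ k') :=
        (hP.bijective x _ hns).unique ⟨hfx k hk, hgval _ (hnT _ (hfx k hk))⟩
          ⟨hfx k' hk', by rw [hy]; exact hgval _ (hnT _ (hfx k' hk'))⟩
      have hF' : (γ k.1).toFun (σ k) ∉ F := fun h => hnT _ (hfx k hk) (.inl (.inl h))
      have hpair := (hcov _ ⟨hγ.mapsTo k.1 (σ k) (hσI k hk), hF'⟩).unique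
        (y₁ := (k.1, σ k)) (y₂ := (k'.1, σ k')) ⟨hσI k hk, rfl⟩ ⟨hσI k' hk', ht.symm⟩
      rw [Prod.mk.injEq] at hpair
      have h2 : (k.2 : ℝ) = k'.2 := by
        have h3 := hσφ k hk
        rw [hpair.1, hpair.2, hσφ k' hk'] at h3
        linarith
      exact Subtype.ext (Prod.ext hpair.1 (Subtype.ext h2))
    · rintro ⟨y, hy, hy1⟩
      have hPy : P.evalEval x y = 0 := by
        rw [← eval_specialize]; exact (Polynomial.mem_roots hsp0).1 hy
      obtain ⟨t, ⟨htf, htg⟩, -⟩ := hP.bijective x y ⟨hPy, .inr (hsing y hPy)⟩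
      have htT := hnT t htf
      obtain ⟨⟨j, s⟩, ⟨hs, hst⟩, -⟩ :=
        hcov t ⟨⟨x, htf, .inl ⟨y, htg, hPy, hxn, hy1⟩⟩, fun h => htT (.inl (.inl h))⟩
      simp only at hs hst
      have hper : φ j s - θ ∈ periods := by
        rw [← exp_mul_I_eq_iff, ← hx, ← OnePoint.coe_eq_coe, ← (hL j).eval_eq s hs, hst, htf]
      let k : Fin n × periods := (j, ⟨φ j s - θ, hper⟩)
      have hks : (k.2 : ℝ) + θ = φ j s := by simp [k]
      have hk : k ∈ S := ⟨s, hs, hks.symm⟩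
      have hσk : σ k = s := by simp only [hσ, hks]; exact (hL j).invFunOn_apply hs
      refine ⟨⟨k, hk⟩, Subtype.ext ?_⟩
      have : prodZpow c₂ β m (τ k) = y := by
        rw [← OnePoint.coe_eq_coe, ← htg, hτ]
        simp only [hσk]
        rw [show k.1 = j from rfl, hst, hgval t htT]
      exact this
  have h1 : ∑ j, ∑' g : periods, pushAlong (γ j) (φ j) w (g + θ) =
      ∑' k : Fin n × periods, pushAlong (γ k.1) (φ k.1) w (k.2 + θ) := by
    rw [ENNReal.tsum_prod (f := fun j (g : periods) => pushAlong (γ j) (φ j) w (g + θ)),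
      tsum_fintype]
  have h2 : (fun k : Fin n × periods => pushAlong (γ k.1) (φ k.1) w (k.2 + θ)) =
      S.indicator fun k => ENNReal.ofReal (w (τ k)) := by
    classical
    funext k
    simp only [pushAlong, indicator_apply]
    rfl
  rw [h1, h2, ← tsum_subtype S, ← Equiv.tsum_eq (Equiv.ofBijective b hb)]
  rfl

/-! ### From the circle to the paths -/

lemma evalP1_zero (t : OnePoint ℂ) : evalP1 0 t = ((0 : ℂ) : OnePoint ℂ) := by
  induction t using OnePoint.rec <;> simp [evalP1]

lemma factored_zero {k : ℕ} (ρ : Fin k → ℂ) (e : Fin k → ℤ) : factored 0 ρ e = 0 := by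
  simp [factored]

lemma measurable_log_norm_prodZpow {k : ℕ} (c : ℂ) (ρ : Fin k → ℂ) (e : Fin k → ℤ) :
    Measurable fun t => Real.log ‖prodZpow c ρ e t‖ := by
  unfold prodZpow
  refine Real.measurable_log.comp (Measurable.norm (measurable_const.mul ?_))
  refine Finset.measurable_fun_prod _ fun i _ => ?_
  have hi : Measurable fun t : ℂ => t - ρ i := measurable_id.sub_const (ρ i)
  rcases e i with n | n
  · simpa using hi.pow_const n
  · simp only [zpow_negSucc]
    exact (hi.pow_const (n + 1)).inv

lemma log_norm_prodZpow_nonneg {P : Polynomial (Polynomial ℂ)} {q : ℕ} {c₂ : ℂ} {β : Fin q → ℂ}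
    {m : Fin q → ℤ} (hm : ∀ s, m s ≠ 0) {f : RatFunc ℂ} {t : OnePoint ℂ}
    (ht : t ∈ outerPreimage P f (factored c₂ β m)) (hi : t ≠ OnePoint.infty) :
    0 ≤ Real.log ‖prodZpow c₂ β m (finitePart t)‖ := by
  by_cases hβ : ∀ s, finitePart t ≠ β s
  · have hg := evalP1_factored_of_ne (c := c₂) (e := m) hβ
    rw [coe_finitePart hi] at hg
    obtain ⟨x, -, ⟨y, hy, hmem⟩ | ⟨-, hy⟩⟩ := ht
    · rw [hg, OnePoint.coe_eq_coe] at hy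
      rw [hy]
      exact Real.log_nonneg hmem.2.2
    · rw [hg] at hy
      exact absurd hy (OnePoint.coe_ne_infty _)
  -- At a zero or pole `β_s` the product is `0`, because `0` to any nonzero integer power is `0`;
  -- then `log 0 = 0`.
  · push Not at hβ
    obtain ⟨s, hs⟩ := hβ
    have : prodZpow c₂ β m (finitePart t) = 0 := by
      rw [prodZpow, Finset.prod_eq_zero (Finset.mem_univ s), mul_zero]
      rw [hs, sub_self, zero_zpow _ (hm s)]
    simp [this]

lemma ArePathsOver.exists_liftedPath {P : Polynomial (Polynomial ℂ)} {p n : ℕ} {c₁ : ℂ}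
    {α : Fin p → ℂ} {l : Fin p → ℤ} (hα : Function.Injective α) (hl : ∀ r, l r ≠ 0)
    {g : RatFunc ℂ} {γ : Fin n → SpherePath} (hγ : ArePathsOver P (factored c₁ α l) g γ)
    (j : Fin n) : ∃ φ E, LiftedPath c₁ α l (γ j) φ E := by
  obtain ⟨E, hE, hd⟩ := (γ j).differentiable
  obtain ⟨φ, hc, hm, hf⟩ := hγ.oriented j
  exact ⟨φ, E, hα, hl, hE, fun s hs => (hd s hs).1, fun s hs => (hd s hs).2, hc, hm, hf⟩

/-- The initial point of a path has `|f| = 1` and `|g| ≥ 1`, which excludes zero constants. Without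
paths they may vanish, so the claim depends on a given `j`. -/
lemma ArePathsOver.const_ne_zero {P : Polynomial (Polynomial ℂ)} {p q n : ℕ} {c₁ c₂ : ℂ}
    {α : Fin p → ℂ} {l : Fin p → ℤ} {β : Fin q → ℂ} {m : Fin q → ℤ} {γ : Fin n → SpherePath}
    (hγ : ArePathsOver P (factored c₁ α l) (factored c₂ β m) γ) (j : Fin n) :
    c₁ ≠ 0 ∧ c₂ ≠ 0 := by
  obtain ⟨x, hx, h⟩ := hγ.mapsTo j (γ j).lo ⟨le_rfl, (γ j).lo_lt_hi.le⟩
  have hxn : ‖x‖ = 1 := by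
    rcases h with ⟨y, -, hy⟩ | ⟨hx, -⟩
    · exact hy.2.1
    · exact hx
  constructor
  · rintro rfl
    rw [factored_zero, evalP1_zero, OnePoint.coe_eq_coe] at hx
    rw [← hx, norm_zero] at hxn
    exact zero_ne_one hxn
  · rintro rfl
    rw [factored_zero, evalP1_zero] at h
    rcases h with ⟨y, hy, hmem⟩ | ⟨-, hy⟩
    · rw [OnePoint.coe_eq_coe] at hy
      have := hmem.2.2
      simp only [← hy, norm_zero] at this
      linarith
    · exact absurd hy (OnePoint.coe_ne_infty _)

/-- Jensen's formula along the curve: the sum over the roots of `P(x, ·)` is an integral of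
`log|g| d arg f` over the paths. -/
theorem integral_sumPosLogRoots_eq {P : Polynomial (Polynomial ℂ)} {p q n : ℕ}
    {c₁ c₂ : ℂ} {α : Fin p → ℂ} {l : Fin p → ℤ} {β : Fin q → ℂ} {m : Fin q → ℤ}
    (hm : ∀ s, m s ≠ 0)
    (hP : IsParametrization P (factored c₁ α l) (factored c₂ β m)) {γ : Fin n → SpherePath}
    (hγ : ArePathsOver P (factored c₁ α l) (factored c₂ β m) γ)
    {φ : Fin n → ℝ → ℝ} {E : Fin n → Set ℝ} (hL : ∀ j, LiftedPath c₁ α l (γ j) (φ j) (E j))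
    (hR : IntegrableOn (fun θ : ℝ => sumPosLogRoots P (Complex.exp (θ * Complex.I)))
      (Icc 0 (2 * Real.pi))) :
    (∀ j, IntervalIntegrable (fun s => Real.log ‖prodZpow c₂ β m (finitePart ((γ j).toFun s))‖ *
      deriv (φ j) s) volume (γ j).lo (γ j).hi) ∧
    ∫ θ in Icc (0 : ℝ) (2 * Real.pi), sumPosLogRoots P (Complex.exp (θ * Complex.I)) =
      ∑ j, ∫ s in (γ j).lo..(γ j).hi,
        Real.log ‖prodZpow c₂ β m (finitePart ((γ j).toFun s))‖ * deriv (φ j) s := by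
  set w : ℂ → ℝ := fun t => Real.log ‖prodZpow c₂ β m t‖ with hw
  have hwm : Measurable w := measurable_log_norm_prodZpow c₂ β m
  set L : Fin n → ℝ → ℝ := fun j s => w (finitePart ((γ j).toFun s)) * deriv (φ j) s with hLd
  set A : Fin n → Set ℝ := fun j => Ioo (γ j).lo (γ j).hi \ E j with hA
  have hL0 (j) : 0 ≤ᵐ[volume.restrict (A j)] L j := by
    filter_upwards [ae_restrict_mem (hL j).measurableSet_domain] with s hs
    exact mul_nonneg (log_norm_prodZpow_nonneg hm
      (hγ.mapsTo j s (Ioo_subset_Icc_self hs.1)) ((hL j).ne_infty s hs)) ((hL j).deriv_nonneg hs)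
  have hLm (j) : AEStronglyMeasurable (L j) (volume.restrict (A j)) :=
    ((hwm.comp_aemeasurable (hL j).aestronglyMeasurable_finitePart.aemeasurable).mul
      (measurable_deriv (φ j)).aemeasurable).aestronglyMeasurable
  obtain ⟨X, hX, hfib⟩ := exists_finite_forall_sumPosLogRoots_eq hP hγ hL
  have key : ENNReal.ofReal (∫ θ in Icc (0 : ℝ) (2 * Real.pi),
      sumPosLogRoots P (Complex.exp (θ * Complex.I))) =
      ∑ j, ∫⁻ s in A j, ENNReal.ofReal (L j s) := by
    rw [ofReal_integral_eq_lintegral_ofReal hR (.of_forall fun θ => sumPosLogRoots_nonneg P _),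
      setLIntegral_congr Ioc_ae_eq_Icc.symm,
      lintegral_congr_ae (ae_restrict_of_ae ((ae_exp_mul_I_notMem hX).mono hfib)),
      lintegral_finsetSum']
    · refine Finset.sum_congr rfl fun j _ => ?_
      rw [lintegral_fold_periods ((hL j).aemeasurable_pushAlong hwm), (hL j).lintegral_pushAlong]
    · intro j _
      refine AEMeasurable.tsum fun g => ?_
      exact (((hL j).aemeasurable_pushAlong hwm).comp_quasiMeasurePreserving
        (measurePreserving_add_left volume (g : ℝ)).quasiMeasurePreserving).restrict
  -- The total is `ENNReal.ofReal` of a real number, so each nonnegative summand is finite. This is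
  -- where integrability of `log|g| d arg f` comes from.
  have hfin (j) : ∫⁻ s in A j, ENNReal.ofReal (L j s) ≠ ⊤ := by
    have := key ▸ ENNReal.ofReal_ne_top
    exact ENNReal.sum_ne_top.1 this j (Finset.mem_univ j)
  have hLi (j) : IntegrableOn (L j) (A j) :=
    ⟨hLm j, (hasFiniteIntegral_iff_ofReal (hL0 j)).2 (hfin j).lt_top⟩
  refine ⟨fun j => ?_, ?_⟩
  · rw [intervalIntegrable_iff_integrableOn_Icc_of_le (γ j).lo_lt_hi.le]
    exact (integrableOn_congr_set_ae (hL j).ae_eq).1 (hLi j)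
  · rw [← ENNReal.toReal_ofReal (integral_nonneg fun θ => sumPosLogRoots_nonneg P _), key,
      ENNReal.toReal_sum fun j _ => hfin j]
    refine Finset.sum_congr rfl fun j _ => ?_
    rw [intervalIntegral.integral_of_le (γ j).lo_lt_hi.le, ← integral_Icc_eq_integral_Ioc,
      ← setIntegral_congr_set (hL j).ae_eq]
    exact (integral_eq_lintegral_of_nonneg_ae (hL0 j) (hLm j)).symm

end MahlerEval

/-! ### The evaluation of `m(P)` -/

open Classical in
theorem mainTheorem2 (P : Polynomial (Polynomial ℂ)) {p q n : ℕ}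
    (c₁ c₂ : ℂ) (α : Fin p → ℂ) (l : Fin p → ℤ) (β : Fin q → ℂ) (m : Fin q → ℤ)
    (hα : Function.Injective α) (hβ : Function.Injective β)
    (hl : ∀ r, l r ≠ 0) (hm : ∀ s, m s ≠ 0)
    (hP : MahlerEval.IsParametrization P
      (MahlerEval.factored c₁ α l) (MahlerEval.factored c₂ β m))
    (γ : Fin n → MahlerEval.SpherePath)
    (hγ : MahlerEval.ArePathsOver P
      (MahlerEval.factored c₁ α l) (MahlerEval.factored c₂ β m) γ) :
    2 * Real.pi * MahlerEval.logMahler₂ P =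
      2 * Real.pi * P.leadingCoeff.logMahlerMeasure +
      ∑ j, (
        (∑ r, ∑ s, if α r = β s then (0 : ℝ) else
          (l r : ℝ) * (m s : ℝ) *
            (MahlerEval.dilogTerm (α r) (β s) (γ j).initial -
              MahlerEval.dilogTerm (α r) (β s) (γ j).terminal)) +
        (∑ r, (l r : ℝ) * Real.log ‖MahlerEval.tildeEval c₂ β m (α r)‖ *
          MahlerEval.wind (γ j) (α r)) -
        (∑ s, (m s : ℝ) * Real.log ‖MahlerEval.tildeEval c₁ α l (β s)‖ *
          MahlerEval.wind (γ j) (β s))) := by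
  choose φ E hL using fun j => hγ.exists_liftedPath hα hl j
  obtain ⟨hR, hmain⟩ := MahlerEval.logMahler₂_eq_integral hP.irreducible.ne_zero
  obtain ⟨hint, hsum⟩ := MahlerEval.integral_sumPosLogRoots_eq hm hP hγ hL hR
  rw [hmain, hsum]
  congr 1
  refine Finset.sum_congr rfl fun j _ => ?_
  obtain ⟨hc₁, hc₂⟩ := hγ.const_ne_zero j
  exact ((hL j).integral_log_norm_mul_deriv hc₁ hc₂ (hint j)).symm
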